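/- Let $\mathcal M$ be the set of finite Borel measures on $\mathbb R$ with finite first moment. For $\eta\in\mathcal M$ write $\overline\eta=\int x\,\eta(dx)$, $P_\eta(k)=\int (k-x)^+\eta(dx)$ and $C_\eta(k)=\int (x-k)^+\eta(dx)$. For $\eta,\chi\in\mathcal M$ of equal mass let $\Pi(\eta,\chi)$ be the set of measures on $\mathbb R^2$ with first marginal $\eta$ and second marginal $\chi$; for $\pi\in\Pi(\eta,\chi)$ write $\pi(dx,dy)=\pi_x(dy)\,\eta(dx)$ for its disintegration. Let $\Pi_M(\eta,\chi)$, $\Pi_{Sub}(\eta,\chi)$ and $\Pi_{Sup}(\eta,\chi)$ be the sets of those $\pi\in\Pi(\eta,\chi)$ for which, for $\eta$-a.e. $x$, respectively $\int y\,\pi_x(dy)=x$, $\int y\,\pi_x(dy)\ge x$ and $\int y\,\pi_x(dy)\le x$. Put $$V(\eta,\chi)=\inf_{\pi\in\Pi(\eta,\chi)}\int_{\mathbb R}\Big|x-\int_{\mathbb R} y\,\pi_x(dy)\Big|\,\eta(dx).$$ Let $\mu,\nu\in\mathcal M$ with $\mu(\mathbb R)=\nu(\mathbb R)$, and let $p=\sup_k\{P_\mu(k)-P_\nu(k)\}$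 and $c=\sup_k\{C_\mu(k)-C_\nu(k)\}$. Suppose that $\min\{p,c\}>0$. Let $\tilde P=P_\nu+p$, and let $x^-=\inf\{k:\tilde P(k)=P_\mu(k)\}$ and $x^+=\sup\{k:\tilde P(k)=P_\mu(k)\}$ (both are real numbers). Set $$\eta^-=\mu|_{(-\infty,x^-)},\qquad \eta^0=\mu|_{[x^-,x^+]},\qquad \eta^+=\mu|_{(x^+,\infty)},$$ $$\chi^-=\nu|_{(-\infty,x^-)}+\big(P_\mu'(x^--)-\tilde P'(x^--)\big)\delta_{x^-},\qquad \chi^+=\nu|_{(x^+,\infty)}+\big(\tilde P'(x^++)-P_\mu'(x^++)\big)\delta_{x^+},$$ and $\chi^0=\nu-\chi^--\chi^+$, where $f'(x-)$ and $f'(x+)$ are the left and right derivatives of $f$ at $x$. Let $\Pi^*(\mu,\nu)$ be the set of all $\pi\in\Pi(\mu,\nu)$ of the form $\pi=\pi^-+\pi^0+\pi^+$ with $\pi^-\in\Pi_{Sub}(\eta^-,\chi^-)$, $\pi^0\in\Pi_M(\eta^0,\chi^0)$ and $\pi^+\in\Pi_{Sup}(\eta^+,\chi^+)$. Then $\Pi^*(\mu,\nu)$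 is non-empty, and for every $\pi^*\in\Pi^*(\mu,\nu)$ $$V(\mu,\nu)=\int_{\mathbb R}\Big|x-\int_{\mathbb R} y\,\pi^*_x(dy)\Big|\,\mu(dx)=\big(\overline{\chi^-}-\overline{\eta^-}\big)+\big(\overline{\eta^+}-\overline{\chi^+}\big)=V(\eta^-,\chi^-)+V(\eta^+,\chi^+).$$ Furthermore, every $\pi\in\Pi(\mu,\nu)$ that attains the infimum in $V(\mu,\nu)$ belongs to $\Pi^*(\mu,\nu)$. -/

import Mathlib

open MeasureTheory ProbabilityTheory Set

namespace WeakOT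

noncomputable section

/-- The first moment `∫ x η(dx)` of a measure on the line (not normalised by the mass). -/
def mean (η : Measure ℝ) : ℝ := ∫ x, x ∂η

/-- The put potential `P_η(k) = ∫ (k - x)⁺ η(dx)`. -/
def putPot (η : Measure ℝ) (k : ℝ) : ℝ := ∫ x, max (k - x) 0 ∂η

/-- The call potential `C_η(k) = ∫ (x - k)⁺ η(dx)`. -/
def callPot (η : Measure ℝ) (k : ℝ) : ℝ := ∫ x, max (x - k) 0 ∂η

/-- `p_{μ,ν} = sup_k (P_μ(k) - P_ν(k))`. -/
def pConst (μ ν : Measure ℝ) : ℝ := ⨆ k : ℝ, (putPot μ k - putPot ν k)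

/-- `c_{μ,ν} = sup_k (C_μ(k) - C_ν(k))`. -/
def cConst (μ ν : Measure ℝ) : ℝ := ⨆ k : ℝ, (callPot μ k - callPot ν k)

/-! ### Couplings and the barycentric `L¹` cost -/

/-- `Π(η, χ)`: the finite measures on the plane with marginals `η` and `χ`. When `η` and `χ` have
finite first moments, so does every member. -/
def couplings (η χ : Measure ℝ) : Set (FiniteMeasure (ℝ × ℝ)) :=
  {π | (π : Measure (ℝ × ℝ)).fst = η ∧ (π : Measure (ℝ × ℝ)).snd = χ}

/-- The barycentre `∫ y π_x(dy)`, where `π(dx, dy) = π_x(dy) η(dx)` is the disintegration of `π`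
with respect to its first marginal `η`. -/
def barycentre (π : FiniteMeasure (ℝ × ℝ)) (x : ℝ) : ℝ :=
  ∫ y, y ∂((π : Measure (ℝ × ℝ)).condKernel x)

/-- `Π_M(η, χ)`: the martingale couplings. -/
def martingaleCouplings (η χ : Measure ℝ) : Set (FiniteMeasure (ℝ × ℝ)) :=
  {π | π ∈ couplings η χ ∧ ∀ᵐ x ∂η, barycentre π x = x}

/-- `Π_Sub(η, χ)`: the submartingale couplings. -/
def submartingaleCouplings (η χ : Measure ℝ) : Set (FiniteMeasure (ℝ × ℝ)) :=
  {π | π ∈ couplings η χ ∧ ∀ᵐ x ∂η, x ≤ barycentre π x}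

/-- `Π_Sup(η, χ)`: the supermartingale couplings. -/
def supermartingaleCouplings (η χ : Measure ℝ) : Set (FiniteMeasure (ℝ × ℝ)) :=
  {π | π ∈ couplings η χ ∧ ∀ᵐ x ∂η, barycentre π x ≤ x}

/-- The barycentric cost `∫ |x - ∫ y π_x(dy)| μ(dx)`. -/
def cost (μ : Measure ℝ) (π : FiniteMeasure (ℝ × ℝ)) : ℝ :=
  ∫ x, |x - barycentre π x| ∂μ

/-- The value `V(μ, ν)` of the barycentric `L¹` weak transport problem. -/
def value (μ ν : Measure ℝ) : ℝ := sInf (cost μ '' couplings μ ν)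

/-! ### The decomposition of the marginals -/

/-- The left derivative `f'(x-)`. -/
def leftDeriv (f : ℝ → ℝ) (x : ℝ) : ℝ := derivWithin f (Iio x) x

/-- The right derivative `f'(x+)`. -/
def rightDeriv (f : ℝ → ℝ) (x : ℝ) : ℝ := derivWithin f (Ioi x) x

/-- `P̃_{μ,ν}(k) = P_ν(k) + p_{μ,ν}`. -/
def shiftedPut (μ ν : Measure ℝ) (k : ℝ) : ℝ := putPot ν k + pConst μ ν

/-- The contact set `{k | P̃_{μ,ν}(k) = P_μ(k)}`. -/
def contactSet (μ ν : Measure ℝ) : Set ℝ := {k | shiftedPut μ ν k = putPot μ k}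

/-- `x⁻`, the left end of the contact set. -/
def xMinus (μ ν : Measure ℝ) : ℝ := sInf (contactSet μ ν)

/-- `x⁺`, the right end of the contact set. -/
def xPlus (μ ν : Measure ℝ) : ℝ := sSup (contactSet μ ν)

/-- `η⁻`, the part of `μ` on `(-∞, x⁻)`. -/
def etaMinus (μ ν : Measure ℝ) : Measure ℝ := μ.restrict (Iio (xMinus μ ν))

/-- `η⁰`, the part of `μ` on `[x⁻, x⁺]`. -/
def etaZero (μ ν : Measure ℝ) : Measure ℝ := μ.restrict (Icc (xMinus μ ν) (xPlus μ ν))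

/-- `η⁺`, the part of `μ` on `(x⁺, ∞)`. -/
def etaPlus (μ ν : Measure ℝ) : Measure ℝ := μ.restrict (Ioi (xPlus μ ν))

/-- `Δ⁻ = P_μ'(x⁻ -)`. -/
def deltaMinus (μ ν : Measure ℝ) : ℝ := leftDeriv (putPot μ) (xMinus μ ν)

/-- `Δ⁺ = P_μ'(x⁺ +)`. -/
def deltaPlus (μ ν : Measure ℝ) : ℝ := rightDeriv (putPot μ) (xPlus μ ν)

/-- `χ⁻`: the part of `ν` on `(-∞, x⁻)` and an atom at `x⁻` of mass `Δ⁻ - P̃'(x⁻ -)`. This mass is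
non-negative because `P_μ ≤ P̃` with equality at `x⁻`, and it makes the masses of `χ⁻` and `η⁻`
equal. -/
def chiMinus (μ ν : Measure ℝ) : Measure ℝ :=
  ν.restrict (Iio (xMinus μ ν)) +
    ENNReal.ofReal (deltaMinus μ ν - leftDeriv (shiftedPut μ ν) (xMinus μ ν)) •
      Measure.dirac (xMinus μ ν)

/-- `χ⁺`: the part of `ν` on `(x⁺, ∞)` and an atom at `x⁺` of mass `P̃'(x⁺ +) - Δ⁺`. This mass is
non-negative because `P_μ ≤ P̃` with equality at `x⁺`, and it makes the masses of `χ⁺` and `η⁺`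
equal. -/
def chiPlus (μ ν : Measure ℝ) : Measure ℝ :=
  ν.restrict (Ioi (xPlus μ ν)) +
    ENNReal.ofReal (rightDeriv (shiftedPut μ ν) (xPlus μ ν) - deltaPlus μ ν) •
      Measure.dirac (xPlus μ ν)

/-- `χ⁰ = ν - χ⁻ - χ⁺`. -/
def chiZero (μ ν : Measure ℝ) : Measure ℝ := ν - chiMinus μ ν - chiPlus μ ν

/-- `Π*(μ, ν)`: the couplings of `μ` and `ν` that are the sum of a submartingale coupling of
`η⁻, χ⁻`, a martingale coupling of `η⁰, χ⁰` and a supermartingale coupling of `η⁺, χ⁺`. -/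
def starCouplings (μ ν : Measure ℝ) : Set (FiniteMeasure (ℝ × ℝ)) :=
  {π | π ∈ couplings μ ν ∧
    ∃ πm ∈ submartingaleCouplings (etaMinus μ ν) (chiMinus μ ν),
    ∃ πz ∈ martingaleCouplings (etaZero μ ν) (chiZero μ ν),
    ∃ πp ∈ supermartingaleCouplings (etaPlus μ ν) (chiPlus μ ν),
      π = πm + πz + πp}

end

end WeakOT

/-! Write `p`, `c` for `pConst`, `cConst`. The value is `p + c`, and the proof has three
ingredients.

Lower bound (`integral_abs_sub_le_cost`): by the triangle inequality and Jensen, every `k` gives `∫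
|x - k| dμ - ∫ |y - k| dν ≤ cost`. The left side is `(P_μ - P_ν)(k) + (C_μ - C_ν)(k)`. By put–call
parity both terms are maximal at the same points, so at a contact point it equals `p + c`.

Equality (`ae_of_cost_eq`, `mem_starCouplings_of_cost_eq`): if the cost is `p + c`, both
inequalities are equalities a.e., at `k = x⁻` and at `k = x⁺`. The barycentre then lies between `x`
and `k`, and no mass crosses `k`. Cutting the coupling at `x⁻` and `x⁺` gives the three pieces and
forces their second marginals.

Attainment (`exists_coupling_cost_le`): let `G`, `H` be the quantile functions of `μ`, `ν`. Where `H
u < G u ≤ G v < H v` with `u ≤ v`, exchanging targets between `u` and `v` moves both barycentres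
towards their sources. A transport of mass `β - p` from `(G - H)⁺ du` to `(H - G)⁺ du`, with `β` the
mass of the latter, pays for exchanges that lower the cost to `p + c`. By the equality case the
result lies in `Π*`.

Conversely members of `Π*` cost at most `p + 0 + c`, summing the costs of the pieces
(`cost_of_mem_starCouplings`). -/

namespace WeakOT

open Filter Topology

/-! ### Potentials -/

section Potentials

variable {η : Measure ℝ} [IsFiniteMeasure η]

theorem integrable_put (hη : Integrable (fun x : ℝ => x) η) (k : ℝ) :
    Integrable (fun x => max (k - x) 0) η :=
  ((integrable_const k).sub hη).sup (integrable_const 0)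

theorem integrable_call (hη : Integrable (fun x : ℝ => x) η) (k : ℝ) :
    Integrable (fun x => max (x - k) 0) η :=
  (hη.sub (integrable_const k)).sup (integrable_const 0)

theorem integrable_abs_sub (hη : Integrable (fun x : ℝ => x) η) (k : ℝ) :
    Integrable (fun x => |x - k|) η :=
  (hη.sub (integrable_const k)).abs

theorem callPot_eq (hη : Integrable (fun x : ℝ => x) η) (k : ℝ) :
    callPot η k = putPot η k + mean η - k * η.real univ := by
  have h : (fun x : ℝ => max (x - k) 0) = fun x => max (k - x) 0 + x - k := by
    funext x
    rcases le_total x k with h | h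
    · rw [max_eq_right (by linarith), max_eq_left (by linarith)]; ring
    · rw [max_eq_left (by linarith), max_eq_right (by linarith)]; ring
  unfold callPot putPot mean
  have h' : Integrable (fun x => max (k - x) 0 + x) η := (integrable_put hη k).add hη
  rw [h, integral_sub h' (integrable_const k), integral_add (integrable_put hη k) hη]
  simp [mul_comm]

theorem integral_abs_sub (hη : Integrable (fun x : ℝ => x) η) (k : ℝ) :
    ∫ x, |x - k| ∂η = putPot η k + callPot η k := by
  unfold callPot putPot
  rw [← integral_add (integrable_put hη k) (integrable_call hη k)]
  congr 1
  funext x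
  rcases le_total x k with h | h
  · rw [abs_of_nonpos (by linarith), max_eq_left (by linarith), max_eq_right (by linarith)]; ring
  · rw [abs_of_nonneg (by linarith), max_eq_right (by linarith), max_eq_left (by linarith)]; ring

theorem integral_sub_Iio (hη : Integrable (fun x : ℝ => x) η) (k : ℝ) :
    putPot η k = k * η.real (Iio k) - ∫ x in Iio k, x ∂η := by
  have h : (fun x : ℝ => max (k - x) 0) = (Iio k).indicator (fun x => k - x) := by
    funext x
    by_cases h : x < k
    · rw [indicator_of_mem (by exact h), max_eq_left (by linarith)]
    · rw [indicator_of_notMem (by exact h), max_eq_right (by linarith)]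
  unfold putPot
  rw [h, integral_indicator measurableSet_Iio,
    integral_sub (integrable_const k) hη.integrableOn]
  simp [mul_comm]

theorem integral_sub_Ioi (hη : Integrable (fun x : ℝ => x) η) (k : ℝ) :
    callPot η k = (∫ x in Ioi k, x ∂η) - k * η.real (Ioi k) := by
  have h : (fun x : ℝ => max (x - k) 0) = (Ioi k).indicator (fun x => x - k) := by
    funext x
    by_cases h : k < x
    · rw [indicator_of_mem (by exact h), max_eq_left (by linarith)]
    · rw [indicator_of_notMem (by exact h), max_eq_right (by linarith)]
  unfold callPot
  rw [h, integral_indicator measurableSet_Ioi,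
    integral_sub hη.integrableOn (integrable_const k)]
  simp [mul_comm]

theorem lipschitzWith_put (x : ℝ) : LipschitzWith 1 (fun k : ℝ => max (k - x) 0) :=
  ((LipschitzWith.id.sub (LipschitzWith.const x)).max_const 0).weaken (by simp)

theorem continuous_putPot (hη : Integrable (fun x : ℝ => x) η) : Continuous (putPot η) := by
  refine continuous_iff_continuousAt.2 fun k₀ => ?_
  refine continuousAt_of_dominated (bound := fun x => max (k₀ + 1 - x) 0)
    (Eventually.of_forall fun k => (integrable_put hη k).aestronglyMeasurable) ?_
    (integrable_put hη _) (Eventually.of_forall fun x => (lipschitzWith_put x).continuous.continuousAt)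
  filter_upwards [Iio_mem_nhds (lt_add_one k₀)] with k hk
  refine Eventually.of_forall fun x => ?_
  rw [Real.norm_of_nonneg (le_max_right _ _)]
  exact max_le_max (by have : k < k₀ + 1 := hk; linarith) le_rfl

theorem tendsto_putPot_atBot (hη : Integrable (fun x : ℝ => x) η) :
    Tendsto (putPot η) atBot (𝓝 0) := by
  have h : Tendsto (fun k : ℝ => ∫ x, max (k - x) 0 ∂η) atBot (𝓝 (∫ _, (0 : ℝ) ∂η)) := by
    refine tendsto_integral_filter_of_dominated_convergence (fun x => max (0 - x) 0)
      (Eventually.of_forall fun k => (integrable_put hη k).aestronglyMeasurable) ?_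
      (integrable_put hη 0) (Eventually.of_forall fun x => ?_)
    · filter_upwards [eventually_le_atBot (0 : ℝ)] with k hk
      refine Eventually.of_forall fun x => ?_
      rw [Real.norm_of_nonneg (le_max_right _ _)]
      exact max_le_max (by linarith) le_rfl
    · refine tendsto_const_nhds.congr' ?_
      filter_upwards [eventually_le_atBot x] with k hk
      rw [max_eq_right (by linarith)]
  rwa [integral_zero] at h

theorem tendsto_callPot_atTop (hη : Integrable (fun x : ℝ => x) η) :
    Tendsto (callPot η) atTop (𝓝 0) := by
  have h : Tendsto (fun k : ℝ => ∫ x, max (x - k) 0 ∂η) atTop (𝓝 (∫ _, (0 : ℝ) ∂η)) := by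
    refine tendsto_integral_filter_of_dominated_convergence (fun x => max (x - 0) 0)
      (Eventually.of_forall fun k => (integrable_call hη k).aestronglyMeasurable) ?_
      (integrable_call hη 0) (Eventually.of_forall fun x => ?_)
    · filter_upwards [eventually_ge_atTop (0 : ℝ)] with k hk
      refine Eventually.of_forall fun x => ?_
      rw [Real.norm_of_nonneg (le_max_right _ _)]
      exact max_le_max (by linarith) le_rfl
    · refine tendsto_const_nhds.congr' ?_
      filter_upwards [eventually_ge_atTop x] with k hk
      rw [max_eq_right (by linarith)]
  rwa [integral_zero] at h

/-- Slopes of the 1-Lipschitz functions `t ↦ (t - x)⁺` are bounded by 1, so dominated convergence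
applies. The filter and the set are left free so that one proof serves both one-sided derivatives,
which differ by the atom at `k`. -/
theorem tendsto_slope_putPot (hη : Integrable (fun x : ℝ => x) η) (k : ℝ) {l : Filter ℝ}
    [l.IsCountablyGenerated] {s : Set ℝ} (hs : MeasurableSet s)
    (h : ∀ x, ∀ᶠ t in l, slope (fun t : ℝ => max (t - x) 0) k t = s.indicator 1 x) :
    Tendsto (slope (putPot η) k) l (𝓝 (η.real s)) := by
  have hsl : slope (putPot η) k = fun t => ∫ x, slope (fun t : ℝ => max (t - x) 0) k t ∂η := by
    funext t
    simp only [slope_def_field, putPot]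
    rw [integral_div, integral_sub (integrable_put hη t) (integrable_put hη k)]
  rw [hsl, ← integral_indicator_one hs]
  refine tendsto_integral_filter_of_dominated_convergence (fun _ => 1)
    (Eventually.of_forall fun t => ?_) (Eventually.of_forall fun t => Eventually.of_forall fun x => ?_)
    (integrable_const 1) (Eventually.of_forall fun x => ?_)
  · simp only [slope_def_field]
    exact (((integrable_put hη t).sub (integrable_put hη k)).div_const _).aestronglyMeasurable
  · rw [slope_def_field, norm_div]
    refine div_le_one_of_le₀ ?_ (norm_nonneg _)
    have := (lipschitzWith_put x).dist_le_mul t k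
    simpa [Real.dist_eq] using this
  · exact tendsto_const_nhds.congr' ((h x).mono fun t ht => ht.symm)

theorem hasDerivWithinAt_putPot_Iio (hη : Integrable (fun x : ℝ => x) η) (k : ℝ) :
    HasDerivWithinAt (putPot η) (η.real (Iio k)) (Iio k) k := by
  rw [hasDerivWithinAt_iff_tendsto_slope' (by simp)]
  refine tendsto_slope_putPot hη k measurableSet_Iio fun x => ?_
  by_cases hx : x < k
  · filter_upwards [Ioo_mem_nhdsLT hx] with t ht
    rw [slope_def_field, indicator_of_mem (by exact hx), max_eq_left (by linarith [ht.1]),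
      max_eq_left (by linarith), Pi.one_apply, sub_sub_sub_cancel_right]
    exact div_self (by linarith [ht.2])
  · filter_upwards [self_mem_nhdsWithin] with t ht
    have ht' : t < k := ht
    rw [slope_def_field, indicator_of_notMem (by exact hx), max_eq_right (by linarith),
      max_eq_right (by linarith), sub_self, zero_div]

theorem hasDerivWithinAt_putPot_Ioi (hη : Integrable (fun x : ℝ => x) η) (k : ℝ) :
    HasDerivWithinAt (putPot η) (η.real (Iic k)) (Ioi k) k := by
  rw [hasDerivWithinAt_iff_tendsto_slope' (by simp)]
  refine tendsto_slope_putPot hη k measurableSet_Iic fun x => ?_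
  by_cases hx : x ≤ k
  · filter_upwards [self_mem_nhdsWithin] with t ht
    have ht' : k < t := ht
    rw [slope_def_field, indicator_of_mem (by exact hx), max_eq_left (by linarith),
      max_eq_left (by linarith), Pi.one_apply, sub_sub_sub_cancel_right]
    exact div_self (by linarith)
  · push Not at hx
    filter_upwards [Ioo_mem_nhdsGT hx] with t ht
    rw [slope_def_field, indicator_of_notMem (by simpa using hx), max_eq_right (by linarith [ht.2]),
      max_eq_right (by linarith), sub_self, zero_div]

theorem leftDeriv_putPot (hη : Integrable (fun x : ℝ => x) η) (k : ℝ) :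
    leftDeriv (putPot η) k = η.real (Iio k) :=
  (hasDerivWithinAt_putPot_Iio hη k).derivWithin (uniqueDiffWithinAt_Iio k)

theorem rightDeriv_putPot (hη : Integrable (fun x : ℝ => x) η) (k : ℝ) :
    rightDeriv (putPot η) k = η.real (Iic k) :=
  (hasDerivWithinAt_putPot_Ioi hη k).derivWithin (uniqueDiffWithinAt_Ioi k)

theorem leftDeriv_shiftedPut (μ : Measure ℝ) (hη : Integrable (fun x : ℝ => x) η) (k : ℝ) :
    leftDeriv (shiftedPut μ η) k = η.real (Iio k) :=
  ((hasDerivWithinAt_putPot_Iio hη k).add_const _).derivWithin (uniqueDiffWithinAt_Iio k)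

theorem rightDeriv_shiftedPut (μ : Measure ℝ) (hη : Integrable (fun x : ℝ => x) η) (k : ℝ) :
    rightDeriv (shiftedPut μ η) k = η.real (Iic k) :=
  ((hasDerivWithinAt_putPot_Ioi hη k).add_const _).derivWithin (uniqueDiffWithinAt_Ioi k)

theorem abs_putPot_sub_le (hη : Integrable (fun x : ℝ => x) η) (k : ℝ) :
    |putPot η k - max k 0 * η.real univ| ≤ ∫ x, |x| ∂η := by
  have h : putPot η k - max k 0 * η.real univ = ∫ x, (max (k - x) 0 - max k 0) ∂η := by
    rw [integral_sub (integrable_put hη k) (integrable_const _)]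
    simp [putPot, mul_comm]
  rw [h]
  refine abs_integral_le_integral_abs.trans
    (integral_mono ((integrable_put hη k).sub (integrable_const _)).abs hη.abs fun x => ?_)
  simpa using abs_max_sub_max_le_abs (k - x) k 0

theorem mem_contactSet {μ ν : Measure ℝ} {k : ℝ} :
    k ∈ contactSet μ ν ↔ putPot μ k - putPot ν k = pConst μ ν := by
  unfold contactSet shiftedPut
  rw [mem_ofPred_eq]
  constructor <;> intro h <;> linarith

end Potentials

/-! ### The contact set -/

section Contact

variable {μ ν : Measure ℝ} [IsFiniteMeasure μ] [IsFiniteMeasure ν]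

theorem chiMinus_eq (hμ : Integrable (fun x : ℝ => x) μ) (hν : Integrable (fun x : ℝ => x) ν) :
    chiMinus μ ν = ν.restrict (Iio (xMinus μ ν)) +
      ENNReal.ofReal (μ.real (Iio (xMinus μ ν)) - ν.real (Iio (xMinus μ ν))) •
        Measure.dirac (xMinus μ ν) := by
  rw [chiMinus, deltaMinus, leftDeriv_putPot hμ, leftDeriv_shiftedPut μ hν]

theorem chiPlus_eq (hμ : Integrable (fun x : ℝ => x) μ) (hν : Integrable (fun x : ℝ => x) ν)
    (hmass : μ univ = ν univ) :
    chiPlus μ ν = ν.restrict (Ioi (xPlus μ ν)) +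
      ENNReal.ofReal (μ.real (Ioi (xPlus μ ν)) - ν.real (Ioi (xPlus μ ν))) •
        Measure.dirac (xPlus μ ν) := by
  rw [chiPlus, deltaPlus, rightDeriv_putPot hμ, rightDeriv_shiftedPut μ hν, ← compl_Iic,
    measureReal_compl measurableSet_Iic, measureReal_compl measurableSet_Iic]
  simp only [Measure.real, hmass]
  congr 3
  ring

/-- Each potential stays within the first absolute moment of `k⁺` times its mass, and equal masses
make these terms cancel. Without boundedness the real `⨆` would take its default value 0. -/
theorem bddAbove_putPot_sub (hμ : Integrable (fun x : ℝ => x) μ)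
    (hν : Integrable (fun x : ℝ => x) ν) (hmass : μ univ = ν univ) :
    BddAbove (range fun k : ℝ => putPot μ k - putPot ν k) := by
  refine ⟨(∫ x, |x| ∂μ) + ∫ x, |x| ∂ν, ?_⟩
  rintro _ ⟨k, rfl⟩
  have h1 := (abs_le.1 (abs_putPot_sub_le hμ k)).2
  have h2 := (abs_le.1 (abs_putPot_sub_le hν k)).1
  have h3 : μ.real univ = ν.real univ := by simp only [Measure.real, hmass]
  rw [h3] at h1
  simp only
  linarith

theorem putPot_sub_le_pConst (hμ : Integrable (fun x : ℝ => x) μ)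
    (hν : Integrable (fun x : ℝ => x) ν) (hmass : μ univ = ν univ) (k : ℝ) :
    putPot μ k - putPot ν k ≤ pConst μ ν :=
  le_ciSup (bddAbove_putPot_sub hμ hν hmass) k

/-- Put–call parity: with equal masses the two differences differ by a constant, so one contact set
serves both `pConst` and `cConst`. -/
theorem callPot_sub_eq (hμ : Integrable (fun x : ℝ => x) μ)
    (hν : Integrable (fun x : ℝ => x) ν) (hmass : μ univ = ν univ) (k : ℝ) :
    callPot μ k - callPot ν k = (putPot μ k - putPot ν k) + (mean μ - mean ν) := by
  have h3 : μ.real univ = ν.real univ := by simp only [Measure.real, hmass]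
  rw [callPot_eq hμ, callPot_eq hν, h3]
  ring

theorem cConst_eq (hμ : Integrable (fun x : ℝ => x) μ)
    (hν : Integrable (fun x : ℝ => x) ν) (hmass : μ univ = ν univ) :
    cConst μ ν = pConst μ ν + (mean μ - mean ν) := by
  unfold cConst
  simp only [callPot_sub_eq hμ hν hmass]
  exact (ciSup_add (bddAbove_putPot_sub hμ hν hmass) _).symm

theorem callPot_sub_of_mem_contactSet (hμ : Integrable (fun x : ℝ => x) μ)
    (hν : Integrable (fun x : ℝ => x) ν) (hmass : μ univ = ν univ) {k : ℝ}
    (hk : k ∈ contactSet μ ν) : callPot μ k - callPot ν k = cConst μ ν := by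
  rw [callPot_sub_eq hμ hν hmass, mem_contactSet.1 hk, cConst_eq hμ hν hmass]

/-- The continuous function `P_μ - P_ν` tends to `0` at `-∞` and to `p - c` at `+∞`. Since `p > 0`
and `c > 0`, both limits are strictly below its supremum `p`, which is therefore attained, and only
inside a compact set. -/
theorem contactSet_compact_nonempty (hμ : Integrable (fun x : ℝ => x) μ)
    (hν : Integrable (fun x : ℝ => x) ν) (hmass : μ univ = ν univ)
    (hp : 0 < pConst μ ν) (hc : 0 < cConst μ ν) :
    IsCompact (contactSet μ ν) ∧ (contactSet μ ν).Nonempty := by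
  set D : ℝ → ℝ := fun k => putPot μ k - putPot ν k with hD
  have hcont : Continuous D := (continuous_putPot hμ).sub (continuous_putPot hν)
  have hbot : Tendsto D atBot (𝓝 0) := by
    simpa using (tendsto_putPot_atBot hμ).sub (tendsto_putPot_atBot hν)
  have htop : Tendsto D atTop (𝓝 (pConst μ ν - cConst μ ν)) := by
    have h := ((tendsto_callPot_atTop hμ).sub (tendsto_callPot_atTop hν)).sub_const (mean μ - mean ν)
    rw [cConst_eq hμ hν hmass]
    have e : pConst μ ν - (pConst μ ν + (mean μ - mean ν)) = 0 - 0 - (mean μ - mean ν) := by ring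
    rw [e]
    refine h.congr fun k => ?_
    rw [callPot_sub_eq hμ hν hmass]
    ring
  have hfar : ∀ a, max 0 (pConst μ ν - cConst μ ν) < a → ∀ᶠ k in cocompact ℝ, D k < a := by
    intro a ha
    rw [cocompact_eq_atBot_atTop]
    exact eventually_sup.2 ⟨hbot.eventually_lt_const ((le_max_left _ _).trans_lt ha),
      htop.eventually_lt_const ((le_max_right _ _).trans_lt ha)⟩
  have hlt : max 0 (pConst μ ν - cConst μ ν) < pConst μ ν := max_lt hp (by linarith)
  obtain ⟨k₀, hk₀⟩ := exists_lt_of_lt_ciSup hlt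
  obtain ⟨k, hk⟩ := hcont.exists_forall_ge' k₀ ((hfar _ hk₀).mono fun x hx => hx.le)
  have hmem : k ∈ contactSet μ ν :=
    mem_contactSet.2 (le_antisymm (putPot_sub_le_pConst hμ hν hmass k) (ciSup_le hk))
  have heq : contactSet μ ν = D ⁻¹' {pConst μ ν} := by
    ext x
    exact mem_contactSet
  refine ⟨?_, k, hmem⟩
  obtain ⟨K, hK, hKsub⟩ := mem_cocompact.1 (hfar _ hlt)
  refine hK.of_isClosed_subset (heq ▸ isClosed_singleton.preimage hcont) fun x hx => ?_
  by_contra hxK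
  have h1 : D x < pConst μ ν := hKsub hxK
  have h2 : D x = pConst μ ν := mem_contactSet.1 hx
  exact absurd h2 h1.ne

theorem xMinus_mem_contactSet (hμ : Integrable (fun x : ℝ => x) μ)
    (hν : Integrable (fun x : ℝ => x) ν) (hmass : μ univ = ν univ)
    (hp : 0 < pConst μ ν) (hc : 0 < cConst μ ν) : xMinus μ ν ∈ contactSet μ ν :=
  let h := contactSet_compact_nonempty hμ hν hmass hp hc
  h.1.sInf_mem h.2

theorem xPlus_mem_contactSet (hμ : Integrable (fun x : ℝ => x) μ)
    (hν : Integrable (fun x : ℝ => x) ν) (hmass : μ univ = ν univ)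
    (hp : 0 < pConst μ ν) (hc : 0 < cConst μ ν) : xPlus μ ν ∈ contactSet μ ν :=
  let h := contactSet_compact_nonempty hμ hν hmass hp hc
  h.1.sSup_mem h.2

theorem xMinus_le_xPlus (hμ : Integrable (fun x : ℝ => x) μ)
    (hν : Integrable (fun x : ℝ => x) ν) (hmass : μ univ = ν univ)
    (hp : 0 < pConst μ ν) (hc : 0 < cConst μ ν) : xMinus μ ν ≤ xPlus μ ν :=
  let h := contactSet_compact_nonempty hμ hν hmass hp hc
  csInf_le_csSup h.2 h.1.bddBelow h.1.bddAbove

end Contact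

/-! ### Couplings, barycentres and the cost -/

section Couplings

variable {η χ : Measure ℝ} {π : FiniteMeasure (ℝ × ℝ)}

theorem integrable_comp_fst {f : ℝ → ℝ} (hπ : π ∈ couplings η χ) (hf : Integrable f η) :
    Integrable (fun z : ℝ × ℝ => f z.1) (π : Measure (ℝ × ℝ)) := by
  rw [← hπ.1] at hf
  exact hf.comp_measurable measurable_fst

theorem integrable_comp_snd {f : ℝ → ℝ} (hπ : π ∈ couplings η χ) (hf : Integrable f χ) :
    Integrable (fun z : ℝ × ℝ => f z.2) (π : Measure (ℝ × ℝ)) := by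
  rw [← hπ.2] at hf
  exact hf.comp_measurable measurable_snd

theorem integral_comp_fst {f : ℝ → ℝ} (hπ : π ∈ couplings η χ) (hf : Integrable f η) :
    ∫ z : ℝ × ℝ, f z.1 ∂(π : Measure (ℝ × ℝ)) = ∫ x, f x ∂η := by
  rw [← hπ.1] at hf ⊢
  exact (integral_map measurable_fst.aemeasurable hf.aestronglyMeasurable).symm

theorem integral_comp_snd {f : ℝ → ℝ} (hπ : π ∈ couplings η χ) (hf : Integrable f χ) :
    ∫ z : ℝ × ℝ, f z.2 ∂(π : Measure (ℝ × ℝ)) = ∫ y, f y ∂χ := by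
  rw [← hπ.2] at hf ⊢
  exact (integral_map measurable_snd.aemeasurable hf.aestronglyMeasurable).symm

theorem measure_univ_eq_of_mem_couplings (hπ : π ∈ couplings η χ) : η univ = χ univ := by
  rw [← hπ.1, ← hπ.2, Measure.fst_univ, Measure.snd_univ]

theorem integrable_barycentre (hχ : Integrable (fun x : ℝ => x) χ) (hπ : π ∈ couplings η χ) :
    Integrable (barycentre π) η := by
  have h := (integrable_comp_snd hπ hχ).integral_condKernel
  rwa [hπ.1] at h

theorem integral_mul_sub_barycentre (hη : Integrable (fun x : ℝ => x) η)
    (hχ : Integrable (fun x : ℝ => x) χ) (hπ : π ∈ couplings η χ) {ψ : ℝ → ℝ}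
    (hψ : Measurable ψ) (hb : ∀ x, |ψ x| ≤ 1) :
    ∫ x, ψ x * (x - barycentre π x) ∂η =
      ∫ z : ℝ × ℝ, ψ z.1 * (z.1 - z.2) ∂(π : Measure (ℝ × ℝ)) := by
  have hi : Integrable (fun z : ℝ × ℝ => ψ z.1 * (z.1 - z.2)) (π : Measure (ℝ × ℝ)) :=
    ((integrable_comp_fst hπ hη).sub (integrable_comp_snd hπ hχ)).bdd_mul
      (hψ.comp measurable_fst).aestronglyMeasurable (Eventually.of_forall fun z => hb z.1)
  rw [← Measure.integral_condKernel hi, hπ.1]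
  have hae := (integrable_comp_snd hπ hχ).condKernel_ae
  rw [hπ.1] at hae
  refine integral_congr_ae ?_
  filter_upwards [hae] with x hx
  rw [integral_const_mul, integral_sub (integrable_const x) hx]
  simp [barycentre]

/-- Duality of `L¹` and `L^∞`, with the sign of `x - barycentre π x` as extremal test function. The
tested integral is linear in `π` and involves no disintegration, so sums of couplings can be
estimated piece by piece. -/
theorem cost_le_of_forall_integral_le (hη : Integrable (fun x : ℝ => x) η)
    (hχ : Integrable (fun x : ℝ => x) χ) (hπ : π ∈ couplings η χ) {C : ℝ}
    (h : ∀ ψ : ℝ → ℝ, Measurable ψ → (∀ x, |ψ x| ≤ 1) →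
      ∫ z : ℝ × ℝ, ψ z.1 * (z.1 - z.2) ∂(π : Measure (ℝ × ℝ)) ≤ C) : cost η π ≤ C := by
  -- The sign is taken of a measurable version of the barycentre, so that `ψ` is an admissible test.
  have hT := (integrable_barycentre hχ hπ).aestronglyMeasurable.aemeasurable
  set T := hT.mk (barycentre π) with hTdef
  set ψ : ℝ → ℝ := fun x => if T x ≤ x then 1 else -1 with hψdef
  have hψ : Measurable ψ :=
    Measurable.ite (measurableSet_le hT.measurable_mk measurable_id) measurable_const
      measurable_const
  have hb : ∀ x, |ψ x| ≤ 1 := by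
    intro x
    by_cases hx : T x ≤ x <;> simp [hψdef, hx]
  refine le_trans (le_of_eq ?_) (h ψ hψ hb)
  rw [← integral_mul_sub_barycentre hη hχ hπ hψ hb]
  refine integral_congr_ae ?_
  filter_upwards [hT.ae_eq_mk] with x hx
  by_cases h' : T x ≤ x
  · simp only [hψdef, h', if_true, hx, one_mul]
    exact abs_of_nonneg (by linarith)
  · simp only [hψdef, h', if_false, hx]
    rw [abs_of_nonpos (by linarith)]
    ring

theorem integral_mul_sub_le_cost (hη : Integrable (fun x : ℝ => x) η)
    (hχ : Integrable (fun x : ℝ => x) χ) (hπ : π ∈ couplings η χ) {ψ : ℝ → ℝ}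
    (hψ : Measurable ψ) (hb : ∀ x, |ψ x| ≤ 1) :
    ∫ z : ℝ × ℝ, ψ z.1 * (z.1 - z.2) ∂(π : Measure (ℝ × ℝ)) ≤ cost η π := by
  rw [← integral_mul_sub_barycentre hη hχ hπ hψ hb]
  have hi : Integrable (fun x => x - barycentre π x) η := hη.sub (integrable_barycentre hχ hπ)
  refine integral_mono (hi.bdd_mul hψ.aestronglyMeasurable (Eventually.of_forall hb)) hi.abs
    fun x => ?_
  refine (le_abs_self _).trans ?_
  rw [abs_mul]
  exact mul_le_of_le_one_left (abs_nonneg _) (hb x)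

theorem integral_sub_eq_mean_sub (hη : Integrable (fun x : ℝ => x) η)
    (hχ : Integrable (fun x : ℝ => x) χ) (hπ : π ∈ couplings η χ) :
    ∫ z : ℝ × ℝ, (z.1 - z.2) ∂(π : Measure (ℝ × ℝ)) = mean η - mean χ := by
  rw [integral_sub (integrable_comp_fst hπ hη) (integrable_comp_snd hπ hχ),
    integral_comp_fst hπ hη, integral_comp_snd hπ hχ]
  rfl

/-- Constant tests `±1`. Sub- and supermartingale couplings attain this bound, hence are optimal for
their own marginals. -/
theorem abs_mean_sub_le_cost (hη : Integrable (fun x : ℝ => x) η)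
    (hχ : Integrable (fun x : ℝ => x) χ) (hπ : π ∈ couplings η χ) :
    |mean η - mean χ| ≤ cost η π := by
  have h1 := integral_mul_sub_le_cost hη hχ hπ (ψ := fun _ => 1) measurable_const (by simp)
  have h2 := integral_mul_sub_le_cost hη hχ hπ (ψ := fun _ => -1) measurable_const (by simp)
  rw [integral_const_mul, integral_sub_eq_mean_sub hη hχ hπ] at h1 h2
  exact abs_le.2 ⟨by linarith, by linarith⟩

theorem integral_sub_barycentre (hη : Integrable (fun x : ℝ => x) η)
    (hχ : Integrable (fun x : ℝ => x) χ) (hπ : π ∈ couplings η χ) :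
    ∫ x, (x - barycentre π x) ∂η = mean η - mean χ := by
  have h := integral_mul_sub_barycentre hη hχ hπ (ψ := fun _ => 1) measurable_const (by simp)
  simp only [one_mul] at h
  rw [h, integral_sub_eq_mean_sub hη hχ hπ]

theorem cost_of_mem_martingaleCouplings (hπ : π ∈ martingaleCouplings η χ) : cost η π = 0 := by
  refine integral_eq_zero_of_ae ?_
  filter_upwards [hπ.2] with x hx
  simp [hx]

theorem cost_of_mem_submartingaleCouplings (hη : Integrable (fun x : ℝ => x) η)
    (hχ : Integrable (fun x : ℝ => x) χ) (hπ : π ∈ submartingaleCouplings η χ) :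
    cost η π = mean χ - mean η := by
  have h : cost η π = ∫ x, -(x - barycentre π x) ∂η := by
    refine integral_congr_ae ?_
    filter_upwards [hπ.2] with x hx
    exact abs_of_nonpos (by linarith)
  rw [h, integral_neg, integral_sub_barycentre hη hχ hπ.1]
  ring

theorem cost_of_mem_supermartingaleCouplings (hη : Integrable (fun x : ℝ => x) η)
    (hχ : Integrable (fun x : ℝ => x) χ) (hπ : π ∈ supermartingaleCouplings η χ) :
    cost η π = mean η - mean χ := by
  have h : cost η π = ∫ x, (x - barycentre π x) ∂η := by
    refine integral_congr_ae ?_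
    filter_upwards [hπ.2] with x hx
    exact abs_of_nonneg (by linarith)
  rw [h, integral_sub_barycentre hη hχ hπ.1]

theorem value_eq_of_forall_le (hπ : π ∈ couplings η χ)
    (h : ∀ π' ∈ couplings η χ, cost η π ≤ cost η π') : value η χ = cost η π :=
  IsLeast.csInf_eq ⟨mem_image_of_mem _ hπ, by rintro _ ⟨π', hπ', rfl⟩; exact h π' hπ'⟩

theorem value_of_mem_submartingaleCouplings (hη : Integrable (fun x : ℝ => x) η)
    (hχ : Integrable (fun x : ℝ => x) χ) (hπ : π ∈ submartingaleCouplings η χ) :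
    value η χ = mean χ - mean η := by
  rw [← cost_of_mem_submartingaleCouplings hη hχ hπ]
  refine value_eq_of_forall_le hπ.1 fun π' hπ' => ?_
  rw [cost_of_mem_submartingaleCouplings hη hχ hπ]
  have h := (abs_le.1 (abs_mean_sub_le_cost hη hχ hπ')).1
  linarith

theorem value_of_mem_supermartingaleCouplings (hη : Integrable (fun x : ℝ => x) η)
    (hχ : Integrable (fun x : ℝ => x) χ) (hπ : π ∈ supermartingaleCouplings η χ) :
    value η χ = mean η - mean χ := by
  rw [← cost_of_mem_supermartingaleCouplings hη hχ hπ]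
  refine value_eq_of_forall_le hπ.1 fun π' hπ' => ?_
  rw [cost_of_mem_supermartingaleCouplings hη hχ hπ]
  exact (le_abs_self _).trans (abs_mean_sub_le_cost hη hχ hπ')

end Couplings

/-! ### The lower bound and its equality case -/

section LowerBound

theorem abs_integral_sub_le {κ : Measure ℝ} [IsProbabilityMeasure κ]
    (hκ : Integrable (fun y : ℝ => y) κ) (k : ℝ) :
    |(∫ y, y ∂κ) - k| ≤ ∫ y, |y - k| ∂κ := by
  have h : (∫ y, y ∂κ) - k = ∫ y, (y - k) ∂κ := by
    rw [integral_sub hκ (integrable_const k)]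
    simp
  rw [h]
  exact abs_integral_le_integral_abs

/-- Equality case of Jensen: `|y - k| + (y - k)` is non-negative with integral at most 0, so it
vanishes a.e., yet it is positive for `y > k`. -/
theorem ae_le_of_integral_abs_sub_le {κ : Measure ℝ} [IsProbabilityMeasure κ]
    (hκ : Integrable (fun y : ℝ => y) κ) {k : ℝ}
    (h : ∫ y, |y - k| ∂κ ≤ k - ∫ y, y ∂κ) : κ (Ioi k) = 0 := by
  have hi : Integrable (fun y : ℝ => y - k) κ := hκ.sub (integrable_const k)
  have h0 : ∫ y, (|y - k| + (y - k)) ∂κ = 0 := by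
    refine le_antisymm ?_ (integral_nonneg fun y => ?_)
    · rw [integral_add hi.abs hi, integral_sub hκ (integrable_const k)]
      simp
      linarith
    · have := neg_abs_le (y - k)
      simp only [Pi.zero_apply]
      linarith
  have hi' : Integrable (fun y : ℝ => |y - k| + (y - k)) κ := hi.abs.add hi
  rw [integral_eq_zero_iff_of_nonneg (fun y => by
    have := neg_abs_le (y - k)
    simp only [Pi.zero_apply]
    linarith) hi'] at h0
  refine measure_mono_null (fun y hy => ?_) h0
  have hy' : k < y := hy
  simp only [mem_compl_iff, mem_ofPred_eq, Pi.zero_apply]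
  have := abs_nonneg (y - k)
  intro h
  linarith

theorem ae_ge_of_integral_abs_sub_le {κ : Measure ℝ} [IsProbabilityMeasure κ]
    (hκ : Integrable (fun y : ℝ => y) κ) {k : ℝ}
    (h : ∫ y, |y - k| ∂κ ≤ (∫ y, y ∂κ) - k) : κ (Iio k) = 0 := by
  have hi : Integrable (fun y : ℝ => y - k) κ := hκ.sub (integrable_const k)
  have h0 : ∫ y, (|y - k| - (y - k)) ∂κ = 0 := by
    refine le_antisymm ?_ (integral_nonneg fun y => ?_)
    · rw [integral_sub hi.abs hi, integral_sub hκ (integrable_const k)]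
      simp
      linarith
    · have := le_abs_self (y - k)
      simp only [Pi.zero_apply]
      linarith
  have hi' : Integrable (fun y : ℝ => |y - k| - (y - k)) κ := hi.abs.sub hi
  rw [integral_eq_zero_iff_of_nonneg (fun y => by
    have := le_abs_self (y - k)
    simp only [Pi.zero_apply]
    linarith) hi'] at h0
  refine measure_mono_null (fun y hy => ?_) h0
  have hy' : y < k := hy
  simp only [mem_compl_iff, mem_ofPred_eq, Pi.zero_apply]
  have := abs_nonneg (y - k)
  intro h
  linarith

variable {η χ : Measure ℝ} {π : FiniteMeasure (ℝ × ℝ)}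

/-- The loss in the triangle inequality and in Jensen's inequality for `|· - k|`. -/
noncomputable def slack (π : FiniteMeasure (ℝ × ℝ)) (k x : ℝ) : ℝ :=
  |x - barycentre π x| + ∫ y, |y - k| ∂((π : Measure (ℝ × ℝ)).condKernel x) - |x - k|

theorem ae_integrable_condKernel (hχ : Integrable (fun x : ℝ => x) χ) (hπ : π ∈ couplings η χ) :
    ∀ᵐ x ∂η, Integrable (fun y : ℝ => y) ((π : Measure (ℝ × ℝ)).condKernel x) := by
  have hae := (integrable_comp_snd hπ hχ).condKernel_ae
  rwa [hπ.1] at hae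

theorem slack_nonneg_ae (hχ : Integrable (fun x : ℝ => x) χ) (hπ : π ∈ couplings η χ) (k : ℝ) :
    ∀ᵐ x ∂η, 0 ≤ slack π k x := by
  filter_upwards [ae_integrable_condKernel hχ hπ] with x hx
  have h1 := abs_integral_sub_le hx k
  have h2 := abs_sub_le x (barycentre π x) k
  have h3 : |barycentre π x - k| ≤ ∫ y, |y - k| ∂((π : Measure (ℝ × ℝ)).condKernel x) := h1
  unfold slack
  linarith

variable [IsFiniteMeasure η] [IsFiniteMeasure χ]

theorem integrable_slack_integral_slack (hη : Integrable (fun x : ℝ => x) η)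
    (hχ : Integrable (fun x : ℝ => x) χ) (hπ : π ∈ couplings η χ) (k : ℝ) :
    Integrable (slack π k) η ∧
      ∫ x, slack π k x ∂η = cost η π + ∫ y, |y - k| ∂χ - ∫ x, |x - k| ∂η := by
  have hi : Integrable (fun x => |x - barycentre π x|) η :=
    (hη.sub (integrable_barycentre hχ hπ)).abs
  have h1 := integrable_comp_snd hπ (integrable_abs_sub hχ k)
  have h2 := h1.integral_condKernel
  have h3 := Measure.integral_condKernel h1
  rw [hπ.1] at h2 h3
  rw [integral_comp_snd hπ (integrable_abs_sub hχ k)] at h3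
  have h4 : Integrable (fun x => |x - barycentre π x| +
      ∫ y, |y - k| ∂((π : Measure (ℝ × ℝ)).condKernel x)) η := hi.add h2
  refine ⟨h4.sub (integrable_abs_sub hη k), ?_⟩
  unfold slack
  rw [integral_sub h4 (integrable_abs_sub hη k), integral_add hi h2, h3]
  rfl

theorem integral_abs_sub_le_cost (hη : Integrable (fun x : ℝ => x) η)
    (hχ : Integrable (fun x : ℝ => x) χ) (hπ : π ∈ couplings η χ) (k : ℝ) :
    ∫ x, |x - k| ∂η - ∫ y, |y - k| ∂χ ≤ cost η π := by
  have h := integral_nonneg_of_ae (slack_nonneg_ae hχ hπ k)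
  rw [(integrable_slack_integral_slack hη hχ hπ k).2] at h
  linarith

/-- The non-negative slack integrates to 0, hence vanishes a.e. Equality in the triangle inequality
puts the barycentre between `x` and `k`; equality in Jensen keeps the kernel on that side of `k`. -/
theorem ae_of_cost_eq (hη : Integrable (fun x : ℝ => x) η)
    (hχ : Integrable (fun x : ℝ => x) χ) (hπ : π ∈ couplings η χ) {k : ℝ}
    (h : cost η π = ∫ x, |x - k| ∂η - ∫ y, |y - k| ∂χ) :
    ∀ᵐ x ∂η,
      (x ≤ k → x ≤ barycentre π x ∧ barycentre π x ≤ k ∧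
        (π : Measure (ℝ × ℝ)).condKernel x (Ioi k) = 0) ∧
      (k ≤ x → barycentre π x ≤ x ∧ k ≤ barycentre π x ∧
        (π : Measure (ℝ × ℝ)).condKernel x (Iio k) = 0) := by
  obtain ⟨hi, hs⟩ := integrable_slack_integral_slack hη hχ hπ k
  have h0 : ∫ x, slack π k x ∂η = 0 := by rw [hs, h]; ring
  rw [integral_eq_zero_iff_of_nonneg_ae (slack_nonneg_ae hχ hπ k) hi] at h0
  filter_upwards [h0, ae_integrable_condKernel hχ hπ] with x hx hκ
  have hx' : |x - barycentre π x| + ∫ y, |y - k| ∂((π : Measure (ℝ × ℝ)).condKernel x)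
      - |x - k| = 0 := hx
  have h1 : |barycentre π x - k| ≤ ∫ y, |y - k| ∂((π : Measure (ℝ × ℝ)).condKernel x) :=
    abs_integral_sub_le hκ k
  have h2 := abs_sub_le x (barycentre π x) k
  have h3 : |x - k| = |x - barycentre π x| + |barycentre π x - k| := by linarith
  have h4 : ∫ y, |y - k| ∂((π : Measure (ℝ × ℝ)).condKernel x) = |barycentre π x - k| := by
    linarith
  refine ⟨fun hxk => ?_, fun hxk => ?_⟩
  · have hab : x ≤ barycentre π x ∧ barycentre π x ≤ k := by
      rw [abs_of_nonpos (by linarith : x - k ≤ 0)] at h3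
      have e1 := neg_abs_le (x - barycentre π x)
      have e2 := neg_abs_le (barycentre π x - k)
      have e3 := abs_nonneg (x - barycentre π x)
      have e4 := abs_nonneg (barycentre π x - k)
      have e5 := le_abs_self (x - barycentre π x)
      have e6 := le_abs_self (barycentre π x - k)
      constructor <;> linarith
    refine ⟨hab.1, hab.2, ae_le_of_integral_abs_sub_le hκ ?_⟩
    rw [h4, abs_of_nonpos (by linarith [hab.2])]
    exact le_of_eq (neg_sub _ _)
  · have hab : barycentre π x ≤ x ∧ k ≤ barycentre π x := by
      rw [abs_of_nonneg (by linarith : 0 ≤ x - k)] at h3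
      have e1 := neg_abs_le (x - barycentre π x)
      have e2 := neg_abs_le (barycentre π x - k)
      have e3 := abs_nonneg (x - barycentre π x)
      have e4 := abs_nonneg (barycentre π x - k)
      have e5 := le_abs_self (x - barycentre π x)
      have e6 := le_abs_self (barycentre π x - k)
      constructor <;> linarith
    refine ⟨hab.1, hab.2, ae_ge_of_integral_abs_sub_le hκ ?_⟩
    rw [h4, abs_of_nonneg (by linarith [hab.2])]
    exact le_rfl

end LowerBound

/-! ### Restricting a coupling to a part of its first marginal -/

section Restriction

variable {η χ : Measure ℝ} {π : FiniteMeasure (ℝ × ℝ)}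

theorem fst_restrict_preimage (ρ : Measure (ℝ × ℝ)) {A : Set ℝ} (hA : MeasurableSet A) :
    (ρ.restrict (Prod.fst ⁻¹' A)).fst = ρ.fst.restrict A :=
  (Measure.restrict_map measurable_fst hA).symm

/-- Uniqueness of disintegration: the kernel of `ρ` also disintegrates the restricted measure.
Barycentre conditions thus pass to the pieces of a coupling. -/
theorem condKernel_restrict_preimage (ρ : Measure (ℝ × ℝ)) [IsFiniteMeasure ρ] {A : Set ℝ}
    (hA : MeasurableSet A) :
    ∀ᵐ x ∂ρ.fst.restrict A,
      ρ.condKernel x = (ρ.restrict (Prod.fst ⁻¹' A)).condKernel x := by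
  rw [← fst_restrict_preimage ρ hA]
  refine eq_condKernel_of_measure_eq_compProd ρ.condKernel ?_
  rw [fst_restrict_preimage ρ hA]
  ext s hs
  rw [Measure.compProd_apply hs, Measure.restrict_apply hs]
  conv_lhs => rw [← ρ.disintegrate ρ.condKernel]
  rw [Measure.compProd_apply (hs.inter (measurable_fst hA)), ← lintegral_indicator hA]
  congr 1
  funext x
  by_cases hx : x ∈ A
  · rw [indicator_of_mem hx]
    congr 1
    ext y
    simp [hx]
  · rw [indicator_of_notMem hx]
    convert measure_empty (μ := ρ.condKernel x)
    ext y
    simp [hx]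

theorem barycentre_restrict_preimage (hπ : π ∈ couplings η χ) {A : Set ℝ} (hA : MeasurableSet A) :
    ∀ᵐ x ∂η.restrict A, barycentre (π.restrict (Prod.fst ⁻¹' A)) x = barycentre π x := by
  rw [← hπ.1]
  filter_upwards [condKernel_restrict_preimage (π : Measure (ℝ × ℝ)) hA] with x hx
  unfold barycentre
  simp only [FiniteMeasure.restrict_measure_eq]
  rw [hx]

theorem snd_restrict_preimage_apply_eq_zero (hπ : π ∈ couplings η χ) {A B : Set ℝ}
    (hA : MeasurableSet A) (hB : MeasurableSet B)
    (h : ∀ᵐ x ∂η, x ∈ A → (π : Measure (ℝ × ℝ)).condKernel x B = 0) :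
    ((π : Measure (ℝ × ℝ)).restrict (Prod.fst ⁻¹' A)).snd B = 0 := by
  have e : Prod.snd ⁻¹' B ∩ Prod.fst ⁻¹' A = A ×ˢ B := by
    ext z
    simp [and_comm]
  rw [Measure.snd_apply hB, Measure.restrict_apply (measurable_snd hB), e,
    ← Measure.setLIntegral_condKernel_eq_measure_prod hA hB, hπ.1,
    lintegral_congr_ae ((ae_restrict_iff' hA).2 h)]
  simp

/-- Whatever mass is not on `S` must sit at `a`. This produces the atoms of `chiMinus` and
`chiPlus`. -/
theorem eq_restrict_add_dirac {σ ν : Measure ℝ} [IsFiniteMeasure σ] {S : Set ℝ} {a : ℝ}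
    (hS : MeasurableSet S) (ha : a ∉ S) (h : σ.restrict S = ν.restrict S)
    (h0 : σ (insert a S)ᶜ = 0) :
    σ = ν.restrict S + ENNReal.ofReal (σ.real univ - ν.real S) • Measure.dirac a := by
  have hm : MeasurableSet (insert a S) := hS.insert a
  have hSeq : ν.real S = σ.real S := by
    rw [← measureReal_restrict_apply_univ S, ← h, measureReal_restrict_apply_univ]
  have hmass : σ.real univ - ν.real S = σ.real {a} := by
    rw [hSeq, ← measureReal_add_measureReal_compl hm]
    have e1 : σ.real (insert a S)ᶜ = 0 := by simp [Measure.real, h0]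
    have e2 : σ.real (insert a S) = σ.real {a} + σ.real S := by
      rw [← singleton_union]
      exact measureReal_union (by simpa using ha) hS
    rw [e1, e2]
    ring
  rw [hmass, ofReal_measureReal, ← Measure.restrict_singleton, ← h,
    ← Measure.restrict_union (by simpa using ha) (measurableSet_singleton a), union_singleton]
  exact (Measure.restrict_eq_self_of_ae_mem h0).symm

end Restriction

/-! ### Couplings of cost `p + c` lie in `Π*`. -/

section Equality

variable {μ ν : Measure ℝ} [IsFiniteMeasure μ] [IsFiniteMeasure ν] {π : FiniteMeasure (ℝ × ℝ)}

theorem integral_abs_sub_of_mem_contactSet (hμ : Integrable (fun x : ℝ => x) μ)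
    (hν : Integrable (fun x : ℝ => x) ν) (hmass : μ univ = ν univ) {k : ℝ}
    (hk : k ∈ contactSet μ ν) :
    ∫ x, |x - k| ∂μ - ∫ y, |y - k| ∂ν = pConst μ ν + cConst μ ν := by
  rw [integral_abs_sub hμ, integral_abs_sub hν, ← mem_contactSet.1 hk,
    ← callPot_sub_of_mem_contactSet hμ hν hmass hk]
  ring

theorem mem_starCouplings_of_cost_eq (hμ : Integrable (fun x : ℝ => x) μ)
    (hν : Integrable (fun x : ℝ => x) ν) (hmass : μ univ = ν univ)
    (hp : 0 < pConst μ ν) (hc : 0 < cConst μ ν) (hπ : π ∈ couplings μ ν)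
    (h : cost μ π = pConst μ ν + cConst μ ν) : π ∈ starCouplings μ ν := by
  have ha := xMinus_mem_contactSet hμ hν hmass hp hc
  have hb := xPlus_mem_contactSet hμ hν hmass hp hc
  have hab := xMinus_le_xPlus hμ hν hmass hp hc
  have hA := ae_of_cost_eq hμ hν hπ
    (h.trans (integral_abs_sub_of_mem_contactSet hμ hν hmass ha).symm)
  have hB := ae_of_cost_eq hμ hν hπ
    (h.trans (integral_abs_sub_of_mem_contactSet hμ hν hmass hb).symm)
  have hchiM := chiMinus_eq hμ hν
  have hchiP := chiPlus_eq hμ hν hmass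
  set a := xMinus μ ν with ha_def
  set b := xPlus μ ν with hb_def
  set ρ : Measure (ℝ × ℝ) := (π : Measure (ℝ × ℝ)) with hρ
  set ρm := ρ.restrict (Prod.fst ⁻¹' Iio a) with hρm
  set ρz := ρ.restrict (Prod.fst ⁻¹' Icc a b) with hρz
  set ρp := ρ.restrict (Prod.fst ⁻¹' Ioi b) with hρp
  have hsum : ρ = ρm + ρz + ρp := by
    have d1 : Disjoint (Iio a) (Icc a b) :=
      disjoint_left.2 fun x h1 h2 => absurd (mem_Iio.1 h1) (not_lt.2 h2.1)
    have d2 : Disjoint (Iio a ∪ Icc a b) (Ioi b) := by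
      rw [Iio_union_Icc_eq_Iic hab]
      exact disjoint_left.2 fun x h1 h2 => absurd (mem_Ioi.1 h2) (not_lt.2 h1)
    rw [hρm, hρz, hρp, ← Measure.restrict_union (d1.preimage _) (measurable_fst measurableSet_Icc),
      ← preimage_union, ← Measure.restrict_union (d2.preimage _) (measurable_fst measurableSet_Ioi),
      ← preimage_union, Iio_union_Icc_eq_Iic hab, Iic_union_Ioi, preimage_univ,
      Measure.restrict_univ]
  have hνsum : ν = ρm.snd + ρz.snd + ρp.snd := by
    rw [← Measure.snd_add, ← Measure.snd_add, ← hsum, hπ.2]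
  have zm : ρm.snd (Ioi a) = 0 :=
    snd_restrict_preimage_apply_eq_zero hπ measurableSet_Iio measurableSet_Ioi
      (hA.mono fun x hx hxa => (hx.1 (le_of_lt hxa)).2.2)
  have zz1 : ρz.snd (Iio a) = 0 :=
    snd_restrict_preimage_apply_eq_zero hπ measurableSet_Icc measurableSet_Iio
      (hA.mono fun x hx hxa => (hx.2 hxa.1).2.2)
  have zz2 : ρz.snd (Ioi b) = 0 :=
    snd_restrict_preimage_apply_eq_zero hπ measurableSet_Icc measurableSet_Ioi
      (hB.mono fun x hx hxa => (hx.1 hxa.2).2.2)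
  have zp : ρp.snd (Iio b) = 0 :=
    snd_restrict_preimage_apply_eq_zero hπ measurableSet_Ioi measurableSet_Iio
      (hB.mono fun x hx hxa => (hx.2 (le_of_lt hxa)).2.2)
  -- The other two pieces do not charge `(-∞, a)`: mass starting in `[a, b]` stays above `a`, mass
  -- starting beyond `b` stays above `b`.
  have rm : ρm.snd.restrict (Iio a) = ν.restrict (Iio a) := by
    rw [hνsum, Measure.restrict_add, Measure.restrict_add, Measure.restrict_eq_zero.2 zz1,
      Measure.restrict_eq_zero.2 (measure_mono_null (Iio_subset_Iio hab) zp), add_zero, add_zero]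
  have rp : ρp.snd.restrict (Ioi b) = ν.restrict (Ioi b) := by
    rw [hνsum, Measure.restrict_add, Measure.restrict_add, Measure.restrict_eq_zero.2 zz2,
      Measure.restrict_eq_zero.2 (measure_mono_null (Ioi_subset_Ioi hab) zm), add_zero, zero_add]
  have fm : ρm.fst = μ.restrict (Iio a) := by
    rw [hρm, fst_restrict_preimage _ measurableSet_Iio, hπ.1]
  have fz : ρz.fst = μ.restrict (Icc a b) := by
    rw [hρz, fst_restrict_preimage _ measurableSet_Icc, hπ.1]
  have fp : ρp.fst = μ.restrict (Ioi b) := by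
    rw [hρp, fst_restrict_preimage _ measurableSet_Ioi, hπ.1]
  have um : ρm.snd.real univ = μ.real (Iio a) := by
    rw [Measure.real, Measure.snd_univ, ← Measure.fst_univ, fm, Measure.restrict_apply_univ]
    rfl
  have up : ρp.snd.real univ = μ.real (Ioi b) := by
    rw [Measure.real, Measure.snd_univ, ← Measure.fst_univ, fp, Measure.restrict_apply_univ]
    rfl
  have sm : ρm.snd = chiMinus μ ν := by
    rw [hchiM, ← um]
    exact eq_restrict_add_dirac measurableSet_Iio (by simp) rm
      (by rwa [Iio_insert, compl_Iic])
  have sp : ρp.snd = chiPlus μ ν := by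
    rw [hchiP, ← up]
    exact eq_restrict_add_dirac measurableSet_Ioi (by simp) rp
      (by rwa [Ioi_insert, compl_Ici])
  have sz : ρz.snd = chiZero μ ν := by
    rw [chiZero, ← sm, ← sp]
    conv_rhs => rw [hνsum]
    rw [add_comm ρm.snd, add_right_comm, Measure.add_sub_cancel, Measure.add_sub_cancel]
  refine ⟨hπ, π.restrict (Prod.fst ⁻¹' Iio a), ⟨⟨?_, ?_⟩, ?_⟩,
    π.restrict (Prod.fst ⁻¹' Icc a b), ⟨⟨?_, ?_⟩, ?_⟩,
    π.restrict (Prod.fst ⁻¹' Ioi b), ⟨⟨?_, ?_⟩, ?_⟩, ?_⟩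
  · rw [FiniteMeasure.restrict_measure_eq]; exact fm
  · rw [FiniteMeasure.restrict_measure_eq]; exact sm
  · filter_upwards [barycentre_restrict_preimage hπ measurableSet_Iio, ae_restrict_of_ae hA,
      ae_restrict_mem measurableSet_Iio] with x h1 h2 h3
    rw [h1]
    exact (h2.1 (le_of_lt h3)).1
  · rw [FiniteMeasure.restrict_measure_eq]; exact fz
  · rw [FiniteMeasure.restrict_measure_eq]; exact sz
  · filter_upwards [barycentre_restrict_preimage hπ measurableSet_Icc, ae_restrict_of_ae hA,
      ae_restrict_of_ae hB, ae_restrict_mem measurableSet_Icc] with x h1 h2 h3 h4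
    rw [h1]
    -- Contact at `a` gives `barycentre ≤ x`, contact at `b` the reverse.
    exact le_antisymm (h2.2 h4.1).1 (h3.1 h4.2).1
  · rw [FiniteMeasure.restrict_measure_eq]; exact fp
  · rw [FiniteMeasure.restrict_measure_eq]; exact sp
  · filter_upwards [barycentre_restrict_preimage hπ measurableSet_Ioi, ae_restrict_of_ae hB,
      ae_restrict_mem measurableSet_Ioi] with x h1 h2 h3
    rw [h1]
    exact (h2.2 (le_of_lt h3)).1
  · apply FiniteMeasure.toMeasure_injective
    simpa [FiniteMeasure.toMeasure_add, FiniteMeasure.restrict_measure_eq] using hsum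

end Equality

/-! ### Quantile functions -/

section Quantile

variable {η : Measure ℝ}

open Classical in
/-- The left-continuous quantile function of `η` on `(0, η(ℝ))`, extended by `0`. -/
noncomputable def quantile (η : Measure ℝ) (s : ℝ) : ℝ :=
  if s ∈ Ioo 0 (η.real univ) then sInf {x | s ≤ η.real (Iic x)} else 0

variable [IsFiniteMeasure η]

/-- The bounds on `s` make the defining set non-empty and bounded below; right-continuity of the
distribution function puts the infimum in it. -/
theorem quantile_le_iff {s : ℝ} (hs : s ∈ Ioo 0 (η.real univ)) (x : ℝ) :
    quantile η s ≤ x ↔ s ≤ η.real (Iic x) := by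
  rw [quantile, if_pos hs]
  set S : Set ℝ := {x | s ≤ η.real (Iic x)} with hS
  have hmono : ∀ {x y : ℝ}, x ≤ y → η.real (Iic x) ≤ η.real (Iic y) := fun h =>
    measureReal_mono (Iic_subset_Iic.2 h)
  have hne : S.Nonempty := by
    have h := (ENNReal.tendsto_toReal (measure_ne_top η univ)).comp (tendsto_measure_Iic_atTop η)
    obtain ⟨x, hx⟩ := (h.eventually_const_lt hs.2).exists
    exact ⟨x, le_of_lt hx⟩
  have hbdd : BddBelow S := by
    have h := (ENNReal.tendsto_toReal (measure_ne_top η univ)).comp (tendsto_measure_Ici_atBot η)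
    obtain ⟨x₀, hx₀⟩ := (h.eventually_const_lt (sub_lt_self _ hs.1)).exists
    refine ⟨x₀, fun y hy => ?_⟩
    by_contra! hlt
    have hd := measureReal_compl (μ := η) (measurableSet_Ici (a := x₀))
    rw [compl_Ici] at hd
    have h1 : η.real (Iic y) ≤ η.real (Iio x₀) := measureReal_mono (Iic_subset_Iio.2 hlt)
    have h2 : s ≤ η.real (Iic y) := hy
    have h3 : η.real univ - s < η.real (Ici x₀) := hx₀
    linarith
  have hmem : sInf S ∈ S := by
    obtain ⟨u, hu, hlt, hlim⟩ := exists_seq_strictAnti_tendsto (sInf S)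
    have hI : ⋂ n, Iic (u n) = Iic (sInf S) := by
      ext y
      simp only [mem_iInter, mem_Iic]
      exact ⟨fun h => ge_of_tendsto' hlim h, fun h n => h.trans (hlt n).le⟩
    have h := tendsto_measure_iInter_atTop (μ := η) (s := fun n => Iic (u n))
      (fun n => measurableSet_Iic.nullMeasurableSet)
      (fun i j hij => Iic_subset_Iic.2 (hu.antitone hij)) ⟨0, measure_ne_top _ _⟩
    rw [hI] at h
    refine ge_of_tendsto' ((ENNReal.tendsto_toReal (measure_ne_top η _)).comp h) fun n => ?_
    obtain ⟨y, hy, hyn⟩ := exists_lt_of_csInf_lt hne (hlt n)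
    exact le_trans hy (hmono hyn.le)
  exact ⟨fun h => le_trans hmem (hmono h), fun h => csInf_le hbdd h⟩

theorem quantile_monotoneOn (η : Measure ℝ) [IsFiniteMeasure η] :
    MonotoneOn (quantile η) (Ioo 0 (η.real univ)) := fun _ hs _ ht hst =>
  (quantile_le_iff hs _).2 (hst.trans ((quantile_le_iff ht _).1 le_rfl))

theorem measurable_quantile (η : Measure ℝ) [IsFiniteMeasure η] : Measurable (quantile η) := by
  refine measurable_of_Iic fun x => ?_
  have h : quantile η ⁻¹' Iic x = (Ioo 0 (η.real univ) ∩ Iic (η.real (Iic x))) ∪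
      ((Ioo 0 (η.real univ))ᶜ ∩ {_s | (0 : ℝ) ≤ x}) := by
    ext s
    by_cases hs : s ∈ Ioo 0 (η.real univ)
    · simp only [mem_preimage, mem_Iic, quantile_le_iff hs, mem_union, mem_inter_iff, hs, true_and,
        mem_compl_iff, not_true_eq_false, false_and, or_false]
    · have h0 : quantile η s = 0 := if_neg hs
      simp only [mem_preimage, mem_Iic, h0, mem_union, mem_inter_iff, hs, false_and,
        mem_compl_iff, not_false_eq_true, true_and, false_or, mem_ofPred_eq]
  rw [h]
  exact (measurableSet_Ioo.inter measurableSet_Iic).union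
    (measurableSet_Ioo.compl.inter (MeasurableSet.const _))

/-- The preimage of `Iic x` in `(0, η(ℝ))` lies between the open and the half-open interval from `0`
to `η(Iic x)`, which have equal length. -/
theorem map_quantile (η : Measure ℝ) [IsFiniteMeasure η] :
    (volume.restrict (Ioo 0 (η.real univ))).map (quantile η) = η := by
  refine (Measure.ext_of_Iic _ _ fun x => ?_).symm
  rw [Measure.map_apply (measurable_quantile η) measurableSet_Iic,
    Measure.restrict_apply (measurable_quantile η measurableSet_Iic)]
  have hle : η.real (Iic x) ≤ η.real univ := measureReal_mono (subset_univ _)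
  have h1 : Ioo 0 (η.real (Iic x)) ⊆ quantile η ⁻¹' Iic x ∩ Ioo 0 (η.real univ) := fun s hs =>
    have hs' : s ∈ Ioo 0 (η.real univ) := ⟨hs.1, hs.2.trans_le hle⟩
    ⟨(quantile_le_iff hs' x).2 hs.2.le, hs'⟩
  have h2 : quantile η ⁻¹' Iic x ∩ Ioo 0 (η.real univ) ⊆ Ioc 0 (η.real (Iic x)) := fun s hs =>
    ⟨hs.2.1, (quantile_le_iff hs.2 x).1 hs.1⟩
  have e : η (Iic x) = ENNReal.ofReal (η.real (Iic x)) := (ofReal_measureReal).symm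
  refine le_antisymm ?_ ?_
  · refine le_trans (le_of_eq ?_) (measure_mono h1)
    rw [Real.volume_Ioo, sub_zero, e]
  · refine (measure_mono h2).trans (le_of_eq ?_)
    rw [Real.volume_Ioc, sub_zero, e]

/-- A shifted comonotone transport of part of `α` into part of `β` that moves mass only to the
right. -/
theorem exists_transport_right {α β : Measure ℝ} [IsFiniteMeasure α] [IsFiniteMeasure β] {p : ℝ}
    (hp : 0 ≤ p) (hpβ : p ≤ β.real univ)
    (h : ∀ u, β.real (Iic u) ≤ α.real (Iic u) + p) (huniv : β.real univ ≤ α.real univ + p) :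
    ∃ γ : Measure (ℝ × ℝ), IsFiniteMeasure γ ∧ γ.map Prod.fst ≤ α ∧ γ.map Prod.snd ≤ β ∧
      (∀ᵐ z ∂γ, z.1 ≤ z.2) ∧ γ.real univ = β.real univ - p := by
  have hα := measurable_quantile α
  have hβ : Measurable fun s => quantile β (s + p) :=
    (measurable_quantile β).comp (measurable_id.add_const p)
  have hαβ : Measurable fun s => (quantile α s, quantile β (s + p)) := hα.prodMk hβ
  have hαm : ∀ s ∈ Ioo 0 (β.real univ - p), s ∈ Ioo 0 (α.real univ) := fun s hs =>
    ⟨hs.1, by linarith [hs.2]⟩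
  have hβm : ∀ s ∈ Ioo 0 (β.real univ - p), s + p ∈ Ioo 0 (β.real univ) := fun s hs =>
    ⟨by linarith [hs.1], by linarith [hs.2]⟩
  -- The lowest `p` units of `β` are left out. With `t = quantile β (s + p)`, one has `s + p ≤ β(Iic
  -- t) ≤ α(Iic t) + p`, which is `quantile α s ≤ t`.
  refine ⟨(volume.restrict (Ioo 0 (β.real univ - p))).map
    fun s => (quantile α s, quantile β (s + p)), inferInstance, ?_, ?_, ?_, ?_⟩
  · rw [Measure.map_map measurable_fst hαβ]
    conv_rhs => rw [← map_quantile α]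
    exact Measure.map_mono (Measure.restrict_mono hαm le_rfl) hα
  · rw [Measure.map_map measurable_snd hαβ]
    conv_rhs => rw [← map_quantile β]
    have hmp := (measurePreserving_add_right (volume : Measure ℝ) p).restrict_preimage
      (measurableSet_Ioo (a := (0 : ℝ)) (b := β.real univ))
    rw [← hmp.map_eq, Measure.map_map (measurable_quantile β) hmp.measurable]
    exact Measure.map_mono (Measure.restrict_mono hβm le_rfl) hβ
  · rw [ae_map_iff hαβ.aemeasurable (measurableSet_le measurable_fst measurable_snd)]
    filter_upwards [ae_restrict_mem measurableSet_Ioo] with s hs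
    rw [quantile_le_iff (hαm s hs)]
    have h1 := (quantile_le_iff (hβm s hs) _).1 le_rfl
    have h2 := h (quantile β (s + p))
    linarith
  · rw [map_measureReal_apply hαβ MeasurableSet.univ, preimage_univ,
      measureReal_restrict_apply_univ, Real.volume_real_Ioo_of_le (by linarith), sub_zero]

end Quantile

/-! ### Exchanging targets along a transport -/

section Exchange

/-- Weighting by at most `1/φ` undoes the density `φ`. This ensures that the exchanged mass fits
into `l`. -/
theorem map_withDensity_le {X : Type*} [MeasurableSpace X] {γ : Measure X} {l : Measure ℝ}
    {f : X → ℝ} (hf : Measurable f) {q : X → ENNReal} {φ : ℝ → ℝ} (hφ : Measurable φ)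
    (hq : ∀ᵐ z ∂γ, q z ≤ ENNReal.ofReal (φ (f z))⁻¹)
    (h : γ.map f ≤ l.withDensity fun x => ENNReal.ofReal (φ x)) :
    (γ.withDensity q).map f ≤ l.restrict {x | 0 < φ x} := by
  have hm : Measurable fun x => ENNReal.ofReal (φ x)⁻¹ := hφ.inv.ennreal_ofReal
  have hpos : MeasurableSet {x | 0 < φ x} := measurableSet_lt measurable_const hφ
  refine Measure.le_iff.2 fun s hs => ?_
  calc (γ.withDensity q).map f s = ∫⁻ z in f ⁻¹' s, q z ∂γ := by
        rw [Measure.map_apply hf hs, withDensity_apply _ (hf hs)]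
    _ ≤ ∫⁻ z in f ⁻¹' s, ENNReal.ofReal (φ (f z))⁻¹ ∂γ :=
        lintegral_mono_ae (ae_restrict_of_ae hq)
    _ = ∫⁻ x in s, ENNReal.ofReal (φ x)⁻¹ ∂γ.map f := (setLIntegral_map hs hm hf).symm
    _ ≤ ∫⁻ x in s, ENNReal.ofReal (φ x)⁻¹ ∂l.withDensity fun x => ENNReal.ofReal (φ x) :=
        lintegral_mono' (Measure.restrict_mono le_rfl h) le_rfl
    _ = ∫⁻ x in s, ENNReal.ofReal (φ x) * ENNReal.ofReal (φ x)⁻¹ ∂l :=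
        setLIntegral_withDensity_eq_setLIntegral_mul l hφ.ennreal_ofReal hm hs
    _ = ∫⁻ x in s, {x | 0 < φ x}.indicator 1 x ∂l := by
        congr 1
        funext x
        by_cases hx : 0 < φ x
        · rw [indicator_of_mem (by exact hx), ← ENNReal.ofReal_mul hx.le, mul_inv_cancel₀ hx.ne']
          simp
        · rw [indicator_of_notMem (by exact hx), ENNReal.ofReal_of_nonpos (not_lt.1 hx), zero_mul]
    _ = l.restrict {x | 0 < φ x} s := by
        rw [lintegral_indicator_one hpos, Measure.restrict_apply hpos, Measure.restrict_apply hs,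
          inter_comm]

/-- The difference is the integral of `g` over the untransported remainder of `α`. -/
theorem abs_integral_sub_le_of_map_le {X : Type*} [MeasurableSpace X] {γ : Measure X}
    [IsFiniteMeasure γ] {α : Measure ℝ} [IsFiniteMeasure α] {f : X → ℝ} (hf : Measurable f)
    (h : γ.map f ≤ α) {g : ℝ → ℝ} (hg : Measurable g) (hb : ∀ x, |g x| ≤ 1) :
    |∫ x, g x ∂α - ∫ z, g (f z) ∂γ| ≤ α.real univ - γ.real univ := by
  have hgi : ∀ τ : Measure ℝ, IsFiniteMeasure τ → Integrable g τ := fun τ _ =>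
    Integrable.of_bound hg.aestronglyMeasurable 1 (Eventually.of_forall hb)
  have hsum := Measure.sub_add_cancel_of_le h
  have h1 : ∫ x, g x ∂α = ∫ x, g x ∂(α - γ.map f) + ∫ z, g (f z) ∂γ := by
    conv_lhs => rw [← hsum]
    rw [integral_add_measure (hgi _ inferInstance) (hgi _ inferInstance),
      integral_map hf.aemeasurable hg.aestronglyMeasurable]
  have h2 : α.real univ = (α - γ.map f).real univ + γ.real univ := by
    conv_lhs => rw [← hsum]
    rw [measureReal_add_apply, map_measureReal_apply hf MeasurableSet.univ, preimage_univ]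
  rw [h1, h2, add_sub_cancel_right, add_sub_cancel_right]
  have h3 := norm_integral_le_of_norm_le_const (μ := α - γ.map f)
    (Eventually.of_forall hb : ∀ᵐ x ∂(α - γ.map f), ‖g x‖ ≤ 1)
  simpa using h3

theorem integral_withDensity_sub {l : Measure ℝ} {D g : ℝ → ℝ} (hD : Measurable D)
    (hDi : Integrable D l) (hg : Measurable g) (hb : ∀ x, |g x| ≤ 1) :
    ∫ x, g x ∂(l.withDensity fun x => ENNReal.ofReal (D x)) -
      ∫ x, g x ∂(l.withDensity fun x => ENNReal.ofReal (-D x)) = ∫ x, g x * D x ∂l := by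
  have hbd : ∀ E : ℝ → ℝ, Integrable E l → Integrable (fun x => max (E x) 0 * g x) l :=
    fun E hE => by
      simpa only [mul_comm] using
        hE.pos_part.bdd_mul hg.aestronglyMeasurable (Eventually.of_forall hb)
  have hDn : Measurable fun x => ENNReal.ofReal (-D x) := hD.neg.ennreal_ofReal
  rw [integral_withDensity_eq_integral_toReal_smul hD.ennreal_ofReal (by simp),
    integral_withDensity_eq_integral_toReal_smul hDn (by simp)]
  simp only [ENNReal.toReal_ofReal', smul_eq_mul]
  rw [← integral_sub (hbd D hDi) (hbd (fun x => -D x) hDi.neg)]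
  congr 1
  funext x
  rcases le_total (D x) 0 with h | h
  · rw [max_eq_right h, max_eq_left (by linarith)]; ring
  · rw [max_eq_left h, max_eq_right (by linarith)]; ring

/-- Let `G` be monotone. A transport `γ` of part of `(G - H)⁺` to part of `(H - G)⁺` moving
mass to the right can be used to exchange the targets of the coupling `(G, H)`, which reduces its
barycentric cost by twice the mass of `γ`. -/
theorem exists_coupling_of_transport {l : Measure ℝ} [IsFiniteMeasure l] {G H : ℝ → ℝ}
    (hG : Measurable G) (hH : Measurable H) (hGi : Integrable G l) (hHi : Integrable H l)
    {I : Set ℝ} (hl : ∀ᵐ u ∂l, u ∈ I) (hGm : MonotoneOn G I)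
    {γ : Measure (ℝ × ℝ)} [IsFiniteMeasure γ]
    (hγ1 : γ.map Prod.fst ≤ l.withDensity fun u => ENNReal.ofReal (G u - H u))
    (hγ2 : γ.map Prod.snd ≤ l.withDensity fun u => ENNReal.ofReal (H u - G u))
    (hγ : ∀ᵐ z ∂γ, z.1 ≤ z.2) :
    ∃ π ∈ couplings (l.map G) (l.map H), cost (l.map G) π ≤
      (l.withDensity fun u => ENNReal.ofReal (G u - H u)).real univ +
      (l.withDensity fun u => ENNReal.ofReal (H u - G u)).real univ - 2 * γ.real univ := by
  have hGH : Measurable fun u => G u - H u := hG.sub hH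
  have hHG : Measurable fun u => H u - G u := hH.sub hG
  have := isFiniteMeasure_withDensity_ofReal (hGi.sub hHi).hasFiniteIntegral
  have := isFiniteMeasure_withDensity_ofReal (hHi.sub hGi).hasFiniteIntegral
  simp only [Pi.sub_apply] at *
  have hpos1 : ∀ᵐ z ∂γ, z.1 ∈ I ∧ H z.1 < G z.1 := by
    have h : ∀ᵐ u ∂(l.withDensity fun u => ENNReal.ofReal (G u - H u)), u ∈ I ∧ H u < G u := by
      rw [ae_withDensity_iff hGH.ennreal_ofReal]
      filter_upwards [hl] with u hu hne
      exact ⟨hu, by simpa using hne⟩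
    exact ae_of_ae_map measurable_fst.aemeasurable (ae_mono hγ1 h)
  have hpos2 : ∀ᵐ z ∂γ, z.2 ∈ I ∧ G z.2 < H z.2 := by
    have h : ∀ᵐ u ∂(l.withDensity fun u => ENNReal.ofReal (H u - G u)), u ∈ I ∧ G u < H u := by
      rw [ae_withDensity_iff hHG.ennreal_ofReal]
      filter_upwards [hl] with u hu hne
      exact ⟨hu, by simpa using hne⟩
    exact ae_of_ae_map measurable_snd.aemeasurable (ae_mono hγ2 h)
  have hpos : ∀ᵐ z ∂γ, 0 < G z.1 - H z.1 ∧ 0 < H z.2 - G z.2 ∧ G z.1 ≤ G z.2 := by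
    filter_upwards [hγ, hpos1, hpos2] with z h h1 h2
    exact ⟨sub_pos.2 h1.2, sub_pos.2 h2.2, hGm h1.1 h2.1 h⟩
  -- For `γ`-a.e. `(u, v)`, `H u < G u ≤ G v < H v`, so `w` dominates both gaps `G u - H u` and `H v
  -- - G v`. Exchanging targets on mass `1/w` shifts the first moment of the targets by exactly 1
  -- per unit of `γ`, up at `u` and down at `v`.
  set w : ℝ × ℝ → ℝ := fun z => H z.2 - H z.1 with hw
  have hwm : Measurable w := (hH.comp measurable_snd).sub (hH.comp measurable_fst)
  set q : ℝ × ℝ → ENNReal := fun z => ENNReal.ofReal (w z)⁻¹ with hq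
  have hqm : Measurable q := hwm.inv.ennreal_ofReal
  set γ' := γ.withDensity q with hγ'
  have hm1 : γ'.map Prod.fst ≤ l.restrict {u | 0 < G u - H u} := by
    refine map_withDensity_le measurable_fst hGH ?_ hγ1
    filter_upwards [hpos] with z hz
    refine ENNReal.ofReal_le_ofReal (inv_anti₀ hz.1 ?_)
    simp only [hw]
    linarith
  have hm2 : γ'.map Prod.snd ≤ l.restrict {u | 0 < H u - G u} := by
    refine map_withDensity_le measurable_snd hHG ?_ hγ2
    filter_upwards [hpos] with z hz
    refine ENNReal.ofReal_le_ofReal (inv_anti₀ hz.2.1 ?_)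
    simp only [hw]
    linarith
  have hle : γ'.map Prod.fst + γ'.map Prod.snd ≤ l := by
    refine (add_le_add hm1 hm2).trans ?_
    rw [← Measure.restrict_union _ (measurableSet_lt measurable_const hHG)]
    · exact Measure.restrict_le_self
    · exact disjoint_left.2 fun u h1 h2 => by
        have h1' : 0 < G u - H u := h1
        have h2' : 0 < H u - G u := h2
        linarith
  have hf1 : γ'.map Prod.fst ≤ l := (Measure.le_add_right le_rfl).trans hle
  have hf2 : γ'.map Prod.snd ≤ l := (Measure.le_add_left le_rfl).trans hle
  have : IsFiniteMeasure (γ'.map Prod.fst) := isFiniteMeasure_of_le l hf1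
  have : IsFiniteMeasure (γ'.map Prod.snd) := isFiniteMeasure_of_le l hf2
  have : IsFiniteMeasure γ' := ⟨by
    have h := measure_lt_top (γ'.map Prod.fst) univ
    rwa [Measure.map_apply measurable_fst MeasurableSet.univ, preimage_univ] at h⟩
  set ρ := l - (γ'.map Prod.fst + γ'.map Prod.snd) with hρ
  have hρsum : ρ + (γ'.map Prod.fst + γ'.map Prod.snd) = l := Measure.sub_add_cancel_of_le hle
  have e1 : Measurable fun u : ℝ => (G u, H u) := hG.prodMk hH
  have e2 : Measurable fun z : ℝ × ℝ => (G z.1, H z.2) :=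
    (hG.comp measurable_fst).prodMk (hH.comp measurable_snd)
  have e3 : Measurable fun z : ℝ × ℝ => (G z.2, H z.1) :=
    (hG.comp measurable_snd).prodMk (hH.comp measurable_fst)
  -- The unused part `ρ` keeps the quantile pairing; along `γ'` the two targets are swapped.
  set P : Measure (ℝ × ℝ) := ρ.map (fun u => (G u, H u)) +
    (γ'.map (fun z => (G z.1, H z.2)) + γ'.map (fun z => (G z.2, H z.1))) with hP
  have hPfst : P.fst = l.map G := by
    conv_rhs => rw [← hρsum]
    rw [hP, Measure.fst, Measure.map_add _ _ measurable_fst, Measure.map_add _ _ measurable_fst,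
      Measure.map_map measurable_fst e1, Measure.map_map measurable_fst e2,
      Measure.map_map measurable_fst e3, Measure.map_add _ _ hG, Measure.map_add _ _ hG,
      Measure.map_map hG measurable_fst, Measure.map_map hG measurable_snd]
    rfl
  have hPsnd : P.snd = l.map H := by
    conv_rhs => rw [← hρsum]
    rw [hP, Measure.snd, Measure.map_add _ _ measurable_snd, Measure.map_add _ _ measurable_snd,
      Measure.map_map measurable_snd e1, Measure.map_map measurable_snd e2,
      Measure.map_map measurable_snd e3, Measure.map_add _ _ hH, Measure.map_add _ _ hH,
      Measure.map_map hH measurable_fst, Measure.map_map hH measurable_snd,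
      add_comm (γ'.map (H ∘ Prod.fst))]
    rfl
  have hGint : Integrable (fun x : ℝ => x) (l.map G) :=
    (integrable_map_measure measurable_id.aestronglyMeasurable hG.aemeasurable).2 hGi
  have hHint : Integrable (fun x : ℝ => x) (l.map H) :=
    (integrable_map_measure measurable_id.aestronglyMeasurable hH.aemeasurable).2 hHi
  have hπ : (⟨P, inferInstance⟩ : FiniteMeasure (ℝ × ℝ)) ∈ couplings (l.map G) (l.map H) :=
    ⟨hPfst, hPsnd⟩
  refine ⟨_, hπ, cost_le_of_forall_integral_le hGint hHint hπ fun ψ hψ hb => ?_⟩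
  set g : ℝ → ℝ := fun u => ψ (G u) with hg
  have hgm : Measurable g := hψ.comp hG
  have hgb : ∀ u, |g u| ≤ 1 := fun u => hb _
  have hFm : Measurable fun z : ℝ × ℝ => ψ z.1 * (z.1 - z.2) :=
    (hψ.comp measurable_fst).mul (measurable_fst.sub measurable_snd)
  have hFi : Integrable (fun z : ℝ × ℝ => ψ z.1 * (z.1 - z.2)) P :=
    ((integrable_comp_fst hπ hGint).sub (integrable_comp_snd hπ hHint)).bdd_mul
      (hψ.comp measurable_fst).aestronglyMeasurable (Eventually.of_forall fun z => hb z.1)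
  have hgDm : Measurable fun u => g u * (G u - H u) := hgm.mul hGH
  have hgD : Integrable (fun u => g u * (G u - H u)) l :=
    (hGi.sub hHi).bdd_mul hgm.aestronglyMeasurable (Eventually.of_forall hgb)
  have hgD1 : Integrable (fun z : ℝ × ℝ => g z.1 * (G z.1 - H z.1)) γ' :=
    (hgD.mono_measure hf1).comp_measurable measurable_fst
  have hgD2 : Integrable (fun z : ℝ × ℝ => g z.2 * (G z.2 - H z.2)) γ' :=
    (hgD.mono_measure hf2).comp_measurable measurable_snd
  have hwi : Integrable w γ' :=
    ((hHi.mono_measure hf2).comp_measurable measurable_snd).sub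
      ((hHi.mono_measure hf1).comp_measurable measurable_fst)
  have hgw : ∀ f : ℝ × ℝ → ℝ, Measurable f → (∀ z, |f z| ≤ 1) →
      Integrable (fun z => f z * w z) γ' ∧ ∫ z, f z * w z ∂γ' = ∫ z, f z ∂γ := by
    intro f hf hfb
    refine ⟨hwi.bdd_mul hf.aestronglyMeasurable (Eventually.of_forall hfb), ?_⟩
    rw [hγ', integral_withDensity_eq_integral_toReal_smul hqm (by simp [hq])]
    refine integral_congr_ae ?_
    filter_upwards [hpos] with z hz
    have hwz : 0 < w z := by
      simp only [hw]
      linarith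
    simp only [hq, ENNReal.toReal_ofReal (inv_nonneg.2 hwz.le), smul_eq_mul]
    field_simp
  obtain ⟨hw1, hw1'⟩ := hgw (fun z => g z.1) (hgm.comp measurable_fst) fun z => hgb _
  obtain ⟨hw2, hw2'⟩ := hgw (fun z => g z.2) (hgm.comp measurable_snd) fun z => hgb _
  have hJ : ∫ u, g u * (G u - H u) ∂l = ∫ u, g u * (G u - H u) ∂ρ +
      (∫ z, g z.1 * (G z.1 - H z.1) ∂γ' + ∫ z, g z.2 * (G z.2 - H z.2) ∂γ') := by
    conv_lhs => rw [← hρsum]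
    rw [integral_add_measure (hgD.mono_measure Measure.sub_le) (hgD.mono_measure hle),
      integral_add_measure (hgD.mono_measure hf1) (hgD.mono_measure hf2),
      integral_map measurable_fst.aemeasurable hgDm.aestronglyMeasurable,
      integral_map measurable_snd.aemeasurable hgDm.aestronglyMeasurable]
  have hK : ∫ z, ψ z.1 * (z.1 - z.2) ∂P = ∫ u, g u * (G u - H u) ∂ρ +
      (∫ z, (g z.1 * (G z.1 - H z.1) - g z.1 * w z) ∂γ' +
        ∫ z, (g z.2 * (G z.2 - H z.2) + g z.2 * w z) ∂γ') := by
    rw [hP] at hFi ⊢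
    rw [integral_add_measure hFi.left_of_add_measure hFi.right_of_add_measure,
      integral_add_measure hFi.right_of_add_measure.left_of_add_measure
        hFi.right_of_add_measure.right_of_add_measure,
      integral_map e1.aemeasurable hFm.aestronglyMeasurable,
      integral_map e2.aemeasurable hFm.aestronglyMeasurable,
      integral_map e3.aemeasurable hFm.aestronglyMeasurable]
    congr 2
    · congr 1
      funext z
      simp only [hg, hw]
      ring
    · congr 1
      funext z
      simp only [hg, hw]
      ring
  -- The weight cancels `w`, so the exchange subtracts `∫ g z.1 dγ` and adds `∫ g z.2 dγ`. What
  -- remains is `g` tested on the leftovers of the two gap measures, each bounded by its leftover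
  -- mass.
  rw [integral_sub hgD1 hw1, integral_add hgD2 hw2, hw1', hw2'] at hK
  have hab := integral_withDensity_sub hGH (hGi.sub hHi) hgm hgb
  simp only [neg_sub] at hab
  have b1 := (abs_le.1 (abs_integral_sub_le_of_map_le measurable_fst hγ1 hgm hgb)).2
  have b2 := (abs_le.1 (abs_integral_sub_le_of_map_le measurable_snd hγ2 hgm hgb)).1
  change ∫ z, ψ z.1 * (z.1 - z.2) ∂P ≤ _
  linarith

end Exchange

/-! ### Existence of an optimal coupling -/

section Existence

theorem withDensity_ofReal_real {l : Measure ℝ} {E : ℝ → ℝ} (hE : Measurable E) {s : Set ℝ}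
    (hs : MeasurableSet s) :
    (l.withDensity fun x => ENNReal.ofReal (E x)).real s = ∫ x in s, max (E x) 0 ∂l := by
  rw [Measure.real, withDensity_apply _ hs,
    ← integral_toReal hE.ennreal_ofReal.aemeasurable (by simp)]
  simp only [ENNReal.toReal_ofReal']

theorem withDensity_ofReal_real_sub {l : Measure ℝ} {E : ℝ → ℝ} (hE : Measurable E)
    (hi : Integrable E l) {s : Set ℝ} (hs : MeasurableSet s) :
    (l.withDensity fun x => ENNReal.ofReal (E x)).real s -
      (l.withDensity fun x => ENNReal.ofReal (-E x)).real s = ∫ x in s, E x ∂l := by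
  rw [withDensity_ofReal_real hE hs, withDensity_ofReal_real (E := fun x => -E x) hE.neg hs,
    ← integral_sub hi.pos_part.integrableOn hi.neg_part.integrableOn]
  congr 1
  funext x
  rcases le_total (E x) 0 with h | h
  · rw [max_eq_right h, max_eq_left (by linarith)]; ring
  · rw [max_eq_left h, max_eq_right (by linarith)]; ring

variable {μ ν : Measure ℝ} [IsFiniteMeasure μ] [IsFiniteMeasure ν]

/-- Let `α`, `β` be the masses of `(G - H)⁺ du` and `(H - G)⁺ du`. Then `β - α = p - c`, and a
rightward transport of mass `β - p` leaves cost at most `α + β - 2(β - p) = p + c`. -/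
theorem exists_coupling_cost_le (hμ : Integrable (fun x : ℝ => x) μ)
    (hν : Integrable (fun x : ℝ => x) ν) (hmass : μ univ = ν univ)
    (hp : 0 ≤ pConst μ ν) (hc : 0 ≤ cConst μ ν) :
    ∃ π ∈ couplings μ ν, cost μ π ≤ pConst μ ν + cConst μ ν := by
  set m := μ.real univ with hm
  have hm' : ν.real univ = m := by simp only [hm, Measure.real, hmass]
  set l : Measure ℝ := volume.restrict (Ioo 0 m) with hl
  set G := quantile μ with hGdef
  set H := quantile ν with hHdef
  have hG : Measurable G := measurable_quantile μ
  have hH : Measurable H := measurable_quantile ν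
  have hGmap : l.map G = μ := map_quantile μ
  have hHmap : l.map H = ν := by
    have h := map_quantile ν
    rwa [hm'] at h
  have hGm : MonotoneOn G (Ioo 0 m) := quantile_monotoneOn μ
  have hHm : MonotoneOn H (Ioo 0 m) := by
    have h := quantile_monotoneOn ν
    rwa [hm'] at h
  have hlI : ∀ᵐ u ∂l, u ∈ Ioo 0 m := ae_restrict_mem measurableSet_Ioo
  have hcompG : ∀ {f : ℝ → ℝ}, Integrable f μ →
      Integrable (fun u => f (G u)) l ∧ ∫ u, f (G u) ∂l = ∫ x, f x ∂μ := by
    intro f hf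
    rw [← hGmap] at hf ⊢
    exact ⟨hf.comp_measurable hG, (integral_map hG.aemeasurable hf.aestronglyMeasurable).symm⟩
  have hcompH : ∀ {f : ℝ → ℝ}, Integrable f ν →
      Integrable (fun u => f (H u)) l ∧ ∫ u, f (H u) ∂l = ∫ x, f x ∂ν := by
    intro f hf
    rw [← hHmap] at hf ⊢
    exact ⟨hf.comp_measurable hH, (integral_map hH.aemeasurable hf.aestronglyMeasurable).symm⟩
  obtain ⟨hGi, hGmean⟩ := hcompG hμ
  obtain ⟨hHi, hHmean⟩ := hcompH hν
  have hHG : Measurable fun u => H u - G u := hH.sub hG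
  have hHGi : Integrable (fun u => H u - G u) l := hHi.sub hGi
  have hput : ∀ k, Integrable (fun u => max (k - G u) 0 - max (k - H u) 0) l ∧
      putPot μ k - putPot ν k = ∫ u, (max (k - G u) 0 - max (k - H u) 0) ∂l := by
    intro k
    have h1 := hcompG (integrable_put hμ k)
    have h2 := hcompH (integrable_put hν k)
    refine ⟨h1.1.sub h2.1, ?_⟩
    rw [integral_sub h1.1 h2.1, h1.2, h2.2]
    rfl
  have htotal : ∫ u, (H u - G u) ∂l = pConst μ ν - cConst μ ν := by
    rw [integral_sub hHi hGi, hGmean, hHmean, cConst_eq hμ hν hmass]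
    unfold mean
    ring
  have hdiff : ∀ {s : Set ℝ}, MeasurableSet s →
      (l.withDensity fun u => ENNReal.ofReal (H u - G u)).real s -
        (l.withDensity fun u => ENNReal.ofReal (G u - H u)).real s = ∫ u in s, (H u - G u) ∂l := by
    intro s hs
    simpa only [neg_sub] using withDensity_ofReal_real_sub hHG hHGi hs
  have : IsFiniteMeasure (l.withDensity fun u => ENNReal.ofReal (H u - G u)) :=
    isFiniteMeasure_withDensity_ofReal hHGi.hasFiniteIntegral
  have : IsFiniteMeasure (l.withDensity fun u => ENNReal.ofReal (G u - H u)) :=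
    isFiniteMeasure_withDensity_ofReal (hGi.sub hHi).hasFiniteIntegral
  have hpβ : pConst μ ν ≤ (l.withDensity fun u => ENNReal.ofReal (H u - G u)).real univ := by
    rw [withDensity_ofReal_real hHG MeasurableSet.univ, Measure.restrict_univ]
    refine ciSup_le fun k => ?_
    rw [(hput k).2]
    refine integral_mono (hput k).1 hHGi.pos_part fun u => ?_
    have h := max_sub_max_le_max (k - G u) 0 (k - H u) 0
    simpa using h
  have hkey : ∀ u, ∫ v in Iic u, (H v - G v) ∂l ≤ pConst μ ν := by
    intro u
    rcases le_or_gt u 0 with hu0 | hu0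
    · have h0 : l.restrict (Iic u) = 0 := by
        rw [Measure.restrict_eq_zero, hl, Measure.restrict_apply measurableSet_Iic]
        convert measure_empty (μ := (volume : Measure ℝ))
        ext v
        simp only [mem_inter_iff, mem_Iic, mem_Ioo, mem_empty_iff_false, iff_false]
        intro h
        linarith [h.1, h.2.1]
      rw [h0, integral_zero_measure]
      exact hp
    rcases le_or_gt m u with hum | hum
    · have h0 : l.restrict (Iic u) = l :=
        Measure.restrict_eq_self_of_ae_mem (hlI.mono fun v hv => hv.2.le.trans hum)
      rw [h0, htotal]
      linarith
    -- At strike `H u`, monotonicity of `H` makes `(H u - H v)⁺` equal to `H u - H v` for `v ≤ u`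
    -- and 0 afterwards, so the put integrand dominates `H - G` on `Iic u` and 0 elsewhere.
    · refine le_trans ?_ (putPot_sub_le_pConst hμ hν hmass (H u))
      rw [(hput (H u)).2, ← integral_indicator measurableSet_Iic]
      refine integral_mono_ae (hHGi.indicator measurableSet_Iic) (hput (H u)).1 ?_
      filter_upwards [hlI] with v hv
      by_cases hvu : v ≤ u
      · have h1 := hHm hv ⟨hu0, hum⟩ hvu
        rw [indicator_of_mem (by exact hvu), max_eq_left (by linarith : 0 ≤ H u - H v)]
        have h2 := le_max_left (H u - G v) 0
        linarith
      · have h1 := hHm ⟨hu0, hum⟩ hv (le_of_not_ge hvu)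
        rw [indicator_of_notMem (by exact hvu), max_eq_right (by linarith : H u - H v ≤ 0),
          sub_zero]
        exact le_max_right _ _
  have htot' := hdiff MeasurableSet.univ
  rw [Measure.restrict_univ, htotal] at htot'
  obtain ⟨γ, hγfin, hγ1, hγ2, hγle, hγmass⟩ := exists_transport_right
    (α := l.withDensity fun u => ENNReal.ofReal (G u - H u)) hp hpβ
    (fun u => by linarith [hkey u, hdiff (measurableSet_Iic (a := u))]) (by linarith)
  obtain ⟨π, hπ, hcost⟩ :=
    exists_coupling_of_transport hG hH hGi hHi hlI hGm hγ1 hγ2 hγle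
  rw [hGmap, hHmap] at hπ
  rw [hGmap] at hcost
  exact ⟨π, hπ, by linarith⟩

end Existence

/-! ### The cost of the couplings in `Π*` -/

section Star

variable {μ ν : Measure ℝ}

theorem integrable_restrict_add_dirac (hν : Integrable (fun x : ℝ => x) ν) (S : Set ℝ) (a d : ℝ) :
    Integrable (fun x : ℝ => x) (ν.restrict S + ENNReal.ofReal d • Measure.dirac a) :=
  hν.restrict.add_measure
    ((integrable_dirac (by simp)).smul_measure ENNReal.ofReal_ne_top)

theorem integrable_chiZero (hν : Integrable (fun x : ℝ => x) ν) :
    Integrable (fun x : ℝ => x) (chiZero μ ν) :=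
  hν.mono_measure (Measure.sub_le.trans Measure.sub_le)

variable [IsFiniteMeasure ν]

theorem mean_restrict_add_dirac (hν : Integrable (fun x : ℝ => x) ν) (S : Set ℝ) {a d : ℝ}
    (h : (ν.restrict S + ENNReal.ofReal d • Measure.dirac a).real univ = ν.real S + d) :
    mean (ν.restrict S + ENNReal.ofReal d • Measure.dirac a) = (∫ x in S, x ∂ν) + d * a := by
  -- The mass hypothesis rules out truncation by `ENNReal.ofReal`, so `d ≥ 0` needs no separate
  -- proof.
  have hd : (ENNReal.ofReal d).toReal = d := by
    have : IsFiniteMeasure (ENNReal.ofReal d • Measure.dirac a : Measure ℝ) :=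
      Measure.smul_finite _ ENNReal.ofReal_ne_top
    rw [measureReal_add_apply, measureReal_restrict_apply_univ, measureReal_ennreal_smul_apply] at h
    simpa using h
  rw [mean, integral_add_measure hν.restrict
    ((integrable_dirac (by simp)).smul_measure ENNReal.ofReal_ne_top), integral_smul_measure, hd]
  simp

variable [IsFiniteMeasure μ]

theorem integrable_chiMinus (hμ : Integrable (fun x : ℝ => x) μ)
    (hν : Integrable (fun x : ℝ => x) ν) : Integrable (fun x : ℝ => x) (chiMinus μ ν) := by
  rw [chiMinus_eq hμ hν]
  exact integrable_restrict_add_dirac hν _ _ _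

theorem integrable_chiPlus (hμ : Integrable (fun x : ℝ => x) μ)
    (hν : Integrable (fun x : ℝ => x) ν) (hmass : μ univ = ν univ) :
    Integrable (fun x : ℝ => x) (chiPlus μ ν) := by
  rw [chiPlus_eq hμ hν hmass]
  exact integrable_restrict_add_dirac hν _ _ _

/-- The atom carries the missing mass at `x⁻`, so the difference of means is `P_μ - P_ν` evaluated
there. The mass identity is supplied by any coupling of the two measures. -/
theorem mean_chiMinus_sub (hμ : Integrable (fun x : ℝ => x) μ)
    (hν : Integrable (fun x : ℝ => x) ν) (ha : xMinus μ ν ∈ contactSet μ ν)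
    (hmass : etaMinus μ ν univ = chiMinus μ ν univ) :
    mean (chiMinus μ ν) - mean (etaMinus μ ν) = pConst μ ν := by
  have h : (chiMinus μ ν).real univ = μ.real (Iio (xMinus μ ν)) := by
    rw [Measure.real, ← hmass, etaMinus, Measure.restrict_apply_univ]
    rfl
  rw [chiMinus_eq hμ hν] at h ⊢
  rw [mean_restrict_add_dirac hν _ (by rw [h]; ring), ← mem_contactSet.1 ha, integral_sub_Iio hμ,
    integral_sub_Iio hν, mean, etaMinus]
  ring

theorem mean_etaPlus_sub (hμ : Integrable (fun x : ℝ => x) μ)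
    (hν : Integrable (fun x : ℝ => x) ν) (hmass' : μ univ = ν univ)
    (hb : xPlus μ ν ∈ contactSet μ ν) (hmass : etaPlus μ ν univ = chiPlus μ ν univ) :
    mean (etaPlus μ ν) - mean (chiPlus μ ν) = cConst μ ν := by
  have h : (chiPlus μ ν).real univ = μ.real (Ioi (xPlus μ ν)) := by
    rw [Measure.real, ← hmass, etaPlus, Measure.restrict_apply_univ]
    rfl
  rw [chiPlus_eq hμ hν hmass'] at h ⊢
  rw [mean_restrict_add_dirac hν _ (by rw [h]; ring),
    ← callPot_sub_of_mem_contactSet hμ hν hmass' hb, integral_sub_Ioi hμ, integral_sub_Ioi hν, mean,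
    etaPlus]
  ring

/-- Every test function splits over the three pieces, whose costs are `p`, `0` and `c`; the general
lower bound gives the reverse inequality. -/
theorem cost_of_mem_starCouplings (hμ : Integrable (fun x : ℝ => x) μ)
    (hν : Integrable (fun x : ℝ => x) ν) (hmass : μ univ = ν univ)
    (hp : 0 < pConst μ ν) (hc : 0 < cConst μ ν) {π : FiniteMeasure (ℝ × ℝ)}
    (hπ : π ∈ starCouplings μ ν) : cost μ π = pConst μ ν + cConst μ ν := by
  have ha := xMinus_mem_contactSet hμ hν hmass hp hc
  have hb := xPlus_mem_contactSet hμ hν hmass hp hc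
  obtain ⟨hπ, πm, hm, πz, hz, πp, hpp, rfl⟩ := hπ
  refine le_antisymm ?_ ?_
  · refine cost_le_of_forall_integral_le hμ hν hπ fun ψ hψ hψb => ?_
    have hFi : Integrable (fun z : ℝ × ℝ => ψ z.1 * (z.1 - z.2))
        ((πm + πz + πp : FiniteMeasure (ℝ × ℝ)) : Measure (ℝ × ℝ)) :=
      ((integrable_comp_fst hπ hμ).sub (integrable_comp_snd hπ hν)).bdd_mul
        (hψ.comp measurable_fst).aestronglyMeasurable (Eventually.of_forall fun z => hψb z.1)
    rw [FiniteMeasure.toMeasure_add, FiniteMeasure.toMeasure_add] at hFi ⊢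
    rw [integral_add_measure hFi.left_of_add_measure hFi.right_of_add_measure,
      integral_add_measure hFi.left_of_add_measure.left_of_add_measure
        hFi.left_of_add_measure.right_of_add_measure]
    have hem : Integrable (fun x : ℝ => x) (etaMinus μ ν) := hμ.restrict
    have hep : Integrable (fun x : ℝ => x) (etaPlus μ ν) := hμ.restrict
    have h1 := integral_mul_sub_le_cost hem (integrable_chiMinus hμ hν) hm.1 hψ hψb
    have h2 := integral_mul_sub_le_cost (η := etaZero μ ν) hμ.restrict (integrable_chiZero hν)
      hz.1 hψ hψb
    have h3 := integral_mul_sub_le_cost hep (integrable_chiPlus hμ hν hmass) hpp.1 hψ hψb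
    rw [cost_of_mem_submartingaleCouplings hem (integrable_chiMinus hμ hν) hm,
      mean_chiMinus_sub hμ hν ha (measure_univ_eq_of_mem_couplings hm.1)] at h1
    rw [cost_of_mem_martingaleCouplings hz] at h2
    rw [cost_of_mem_supermartingaleCouplings hep (integrable_chiPlus hμ hν hmass) hpp,
      mean_etaPlus_sub hμ hν hmass hb (measure_univ_eq_of_mem_couplings hpp.1)] at h3
    linarith
  · rw [← integral_abs_sub_of_mem_contactSet hμ hν hmass ha]
    exact integral_abs_sub_le_cost hμ hν hπ _

end Star

end WeakOT

open WeakOT in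
theorem mainTheorem1 (μ ν : Measure ℝ) [IsFiniteMeasure μ] [IsFiniteMeasure ν]
    (hμ : Integrable (fun x : ℝ => x) μ) (hν : Integrable (fun x : ℝ => x) ν)
    (hmass : μ Set.univ = ν Set.univ)
    (hpc : 0 < min (WeakOT.pConst μ ν) (WeakOT.cConst μ ν)) :
    (WeakOT.starCouplings μ ν).Nonempty ∧
    (∀ π ∈ WeakOT.starCouplings μ ν, WeakOT.value μ ν = WeakOT.cost μ π) ∧
    WeakOT.value μ ν =
      (WeakOT.mean (WeakOT.chiMinus μ ν) - WeakOT.mean (WeakOT.etaMinus μ ν)) +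
        (WeakOT.mean (WeakOT.etaPlus μ ν) - WeakOT.mean (WeakOT.chiPlus μ ν)) ∧
    WeakOT.value μ ν =
      WeakOT.value (WeakOT.etaMinus μ ν) (WeakOT.chiMinus μ ν) +
        WeakOT.value (WeakOT.etaPlus μ ν) (WeakOT.chiPlus μ ν) ∧
    (∀ π ∈ WeakOT.couplings μ ν, WeakOT.cost μ π = WeakOT.value μ ν →
      π ∈ WeakOT.starCouplings μ ν) := by

  obtain ⟨hp, hc⟩ := lt_min_iff.1 hpc
  have ha := xMinus_mem_contactSet hμ hν hmass hp hc
  have hb := xPlus_mem_contactSet hμ hν hmass hp hc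
  have hlower : ∀ π ∈ couplings μ ν, pConst μ ν + cConst μ ν ≤ cost μ π := fun π hπ => by
    rw [← integral_abs_sub_of_mem_contactSet hμ hν hmass ha]
    exact integral_abs_sub_le_cost hμ hν hπ _
  obtain ⟨π₀, hπ₀, hle⟩ := exists_coupling_cost_le hμ hν hmass hp.le hc.le
  have hcost₀ : cost μ π₀ = pConst μ ν + cConst μ ν := le_antisymm hle (hlower _ hπ₀)
  have hvalue : value μ ν = pConst μ ν + cConst μ ν := by
    rw [← hcost₀]
    exact value_eq_of_forall_le hπ₀ fun π hπ => hcost₀.trans_le (hlower π hπ)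
  have hstar := mem_starCouplings_of_cost_eq hμ hν hmass hp hc hπ₀ hcost₀
  -- The outer pieces of one optimal coupling provide the mass identities and the optimisers for the
  -- two outer problems.
  obtain ⟨-, πm, hm, πz, hz, πp, hpp, -⟩ := id hstar
  have hm' := mean_chiMinus_sub hμ hν ha (measure_univ_eq_of_mem_couplings hm.1)
  have hp' := mean_etaPlus_sub hμ hν hmass hb (measure_univ_eq_of_mem_couplings hpp.1)
  refine ⟨⟨π₀, hstar⟩, fun π hπ => ?_, ?_, ?_, fun π hπ h => ?_⟩
  · rw [hvalue, cost_of_mem_starCouplings hμ hν hmass hp hc hπ]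
  · rw [hvalue, hm', hp']
  · rw [hvalue,
      value_of_mem_submartingaleCouplings (η := etaMinus μ ν) hμ.restrict
        (integrable_chiMinus hμ hν) hm,
      value_of_mem_supermartingaleCouplings (η := etaPlus μ ν) hμ.restrict
        (integrable_chiPlus hμ hν hmass) hpp, hm', hp']
  · exact mem_starCouplings_of_cost_eq hμ hν hmass hp hc hπ (h.trans hvalue)
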